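/- Let $q\in\{4,5\}$ and $m\ge 3$, and let $Q$ be a nondegenerate quadratic form (of plus or minus type; nondegenerate means that the bilinear form $Q(x+y)-Q(x)-Q(y)$ is nondegenerate) on a $2m$-dimensional vector space $V$ over $\mathbb{F}_q$. Let $\Omega(V,Q)$ be the derived subgroup of the isometry group $\mathrm{O}(V,Q)$ and let $\mathrm{P}\Omega(V,Q)\cong \mathrm{P}\Omega_{2m}^{\pm}(q)$ be the group of permutations of the $1$-spaces of $V$ that it induces. Let $G$ be a primitive permutation group on a finite set $X$ whose socle $S$ (the subgroup generated by the minimal normal subgroups of $G$) is isomorphic to $\mathrm{P}\Omega(V,Q)$, such that for a point $a\in X$ with stabiliser $H=G_a$ some isomorphism $S\to\mathrm{P}\Omega(V,Q)$ maps $S\cap H$ onto the stabiliser $N_1$ of a nonsingular $1$-space of $V$, that is, a $1$-space $\langle v\rangle$ with $Q(v)\neq 0$. Then none of the non-diagonal orbital graphs of $G$ is strongly regular: for every orbit $\Delta\neq\{(x,x):x\in X\}$ of $G$ on $X\times X$, the undirected graph with vertex set $X$ and edge set $\Delta\cup\Delta^*$, where $\Delta^*=\{(y,x):(x,y)\in\Delta\}$,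 is not strongly regular for any parameters $(v,k,\lambda,\mu)$. (A graph is strongly regular with these parameters if it has $v$ vertices, is regular of degree $k$, any two adjacent vertices have exactly $\lambda$ common neighbours, and any two distinct non-adjacent vertices have exactly $\mu$ common neighbours.) -/

import Mathlib

open scoped LinearAlgebra.Projectivization

section Socle

variable {G : Type*} [Group G]

/-- `N` is a minimal normal subgroup of `G`. -/
def IsMinimalNormalSubgroup (N : Subgroup G) : Prop :=
  N.Normal ∧ N ≠ ⊥ ∧ ∀ M : Subgroup G, M.Normal → M ≤ N → M = ⊥ ∨ M = N

variable (G) in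
/-- The socle of a group: the subgroup generated by all minimal normal subgroups. -/
def groupSocle : Subgroup G :=
  sSup {N : Subgroup G | IsMinimalNormalSubgroup N}

end Socle

section Orthogonal

variable {K V : Type*} [Field K] [AddCommGroup V] [Module K V]

/-- The group `O(V, Q)` of all linear isometries of the quadratic form `Q`. -/
def isometryGroup (Q : QuadraticForm K V) : Subgroup (V ≃ₗ[K] V) where
  carrier := {g | ∀ v, Q (g v) = Q v}
  one_mem' := fun _ => rfl
  mul_mem' := by
    intro a b ha hb v
    rw [LinearEquiv.mul_apply, ha, hb]
  inv_mem' := by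
    intro a ha v
    have h := ha (a⁻¹ v)
    rw [← LinearEquiv.mul_apply, mul_inv_cancel] at h
    exact h.symm

/-- The group `Ω(V, Q)`, the derived subgroup of `O(V, Q)`. -/
def omegaGroup (Q : QuadraticForm K V) : Subgroup (V ≃ₗ[K] V) :=
  ⁅isometryGroup Q, isometryGroup Q⁆

/-- The group `PΩ(V, Q)`: the group of permutations of the `1`-spaces of `V` induced by
`Ω(V, Q)`, that is, the quotient of `Ω(V, Q)` by the scalars that it contains. -/
def pOmegaGroup (Q : QuadraticForm K V) : Subgroup (Equiv.Perm (ℙ K V)) :=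
  (omegaGroup Q).map (MulAction.toPermHom (V ≃ₗ[K] V) (ℙ K V))

/-- The `1`-space `p` is nonsingular: `Q` does not vanish at a nonzero vector of `p`. -/
def IsNonsingularPoint (Q : QuadraticForm K V) (p : ℙ K V) : Prop :=
  ∀ v ∈ p.submodule, v ≠ 0 → Q v ≠ 0

end Orthogonal

section OrbitalGraphs

/-- `Δ` is an orbital of `G` on `X`: an orbit of `G` on `X × X`. -/
def IsOrbital (G : Type*) {X : Type*} [Group G] [MulAction G X] (Δ : Set (X × X)) : Prop :=
  ∃ z : X × X, Δ = MulAction.orbit G z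

/-- The undirected graph with edge set `Δ ∪ Δ*`, where `Δ*` is the reverse of `Δ`
(pairs on the diagonal are discarded). -/
def orbitalGraph {X : Type*} (Δ : Set (X × X)) : SimpleGraph X :=
  SimpleGraph.fromRel fun x y => (x, y) ∈ Δ

open Classical in
/-- `Γ` is strongly regular, for some parameters `(v, k, l, μ)`. -/
def IsStronglyRegular {X : Type*} [Fintype X] (Γ : SimpleGraph X) : Prop :=
  ∃ v k l μ : ℕ, Γ.IsSRGWith v k l μ

end OrbitalGraphs

/-! Scaling `Q` does not change PΩ, so the nonsingular 1-space may be taken to be spanned by a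
vector of norm 1, and `X` becomes the set of pairs ±z with Q(z) = 1. Products of reflections show
that the socle S is transitive on ordered pairs of distinct points (±x, ±y) with a given value of
(x, y)², where (·,·) is the polar form; the intermediate vectors needed are found by counting
(`QuadricCounts.exists_omega_fixing`). Hence a non-diagonal orbital of G consists of the pairs of
distinct points whose type (x, y)² lies in a set A of squares. As G normalises S and permutes
transitively the S-orbitals inside it, these all have the same valency.

In even dimension 2m the Gauss sum of tQ is εq^m for every t ≠ 0, so `card_affine_quadric` gives the
number of z of norm 1 with one or two prescribed pairings: a main term plus an error term of sign ε
that is linear in the number of roots of a quadratic polynomial or of points of a conic over the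
field. With Z = q^(m-2) ≥ q, equal valencies force the types in A to share their number of square
roots and their root counts, and A contains the type 4 of a point with itself only if A = {4}.

For non-adjacent points with pairing γ, the number of common neighbours is, up to the factor |{1,
-1}|, a constant plus εZ times `pairCount A γ`. Thus m and ε drop out, and a finite check over the
field (`ConicsSeparate`) finds, for each admissible A, two values γ with different counts. So μ
cannot be constant. -/

/-! ### Gauss sums of quadratic forms -/

section GaussSums

variable {K V : Type*} [Field K] [AddCommGroup V] [Module K V] [Fintype V]

/-- Orthogonality of additive characters, along a linear form. -/
theorem sum_addChar_linearForm {ψ : AddChar K ℂ} (hψ : ψ ≠ 1) (ℓ : V →ₗ[K] K)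
    [Decidable (ℓ = 0)] :
    ∑ x, ψ (ℓ x) = if ℓ = 0 then (Fintype.card V : ℂ) else 0 := by
  classical
  have h := AddChar.sum_eq_ite (ψ.compAddMonoidHom ℓ.toAddMonoidHom)
  simp only [AddChar.compAddMonoidHom_apply, LinearMap.toAddMonoidHom_coe] at h
  rw [h]
  refine if_congr ⟨fun h0 => ?_, fun h0 => ?_⟩ rfl rfl
  · by_contra hne
    obtain ⟨x, hx⟩ : ∃ x, ℓ x ≠ 0 := by
      by_contra! hall
      exact hne (LinearMap.ext hall)
    apply hψ
    ext a
    have := DFunLike.congr_fun h0 ((a * (ℓ x)⁻¹) • x)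
    simpa [AddChar.compAddMonoidHom_apply, hx] using this
  · subst h0
    ext x
    simp [AddChar.compAddMonoidHom_apply]

/-- The Gauss sum of the quadratic form `t Q`. -/
noncomputable def quadraticGaussSum (ψ : AddChar K ℂ) (Q : QuadraticForm K V) (t : K) : ℂ :=
  ∑ x, ψ (t * Q x)

/-- In the double sum over x and y put x = y + h: the exponent tQ(x) - tQ(y) is affine in y with
linear part t(h, y), so by nondegeneracy only h = 0 survives. -/
theorem quadraticGaussSum_mul_neg {ψ : AddChar K ℂ} (hψ : ψ ≠ 1) {Q : QuadraticForm K V}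
    (hQ : Q.polarBilin.Nondegenerate) {t : K} (ht : t ≠ 0) :
    quadraticGaussSum ψ Q t * quadraticGaussSum ψ Q (-t) = Fintype.card V := by
  classical
  unfold quadraticGaussSum
  have key : ∀ y : V, ∑ x, ψ (t * Q x) * ψ (-t * Q y) =
      ∑ h, ψ (t * Q h) * ψ ((t • Q.polarBilin h) y) := by
    intro y
    rw [← Equiv.sum_comp (Equiv.addRight y)]
    refine Finset.sum_congr rfl fun h _ => ?_
    rw [← AddChar.map_add_eq_mul, ← AddChar.map_add_eq_mul]
    congr 1
    simp only [Equiv.coe_addRight, LinearMap.smul_apply, QuadraticMap.polarBilin_apply_apply,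
      QuadraticMap.polar, smul_eq_mul]
    ring
  rw [Finset.sum_mul_sum, Finset.sum_comm, Finset.sum_congr rfl fun y _ => key y, Finset.sum_comm]
  simp_rw [← Finset.mul_sum, sum_addChar_linearForm hψ]
  rw [Finset.sum_eq_single 0]
  · simp
  · intro h _ hh
    rw [if_neg, mul_zero]
    intro h0
    apply hh
    apply hQ.1
    intro y
    have := LinearMap.congr_fun h0 y
    simpa [ht] using this
  · simp

theorem quadraticGaussSum_mul_sq (ψ : AddChar K ℂ) (Q : QuadraticForm K V) (t : K) {b : K}
    (hb : b ≠ 0) : quadraticGaussSum ψ Q (b * b * t) = quadraticGaussSum ψ Q t := by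
  unfold quadraticGaussSum
  rw [← Equiv.sum_comp (LinearEquiv.smulOfNeZero K V b hb).toEquiv (fun x => ψ (t * Q x))]
  refine Finset.sum_congr rfl fun x _ => ?_
  congr 1
  simp [QuadraticMap.map_smul]
  ring

end GaussSums

theorem addChar_map_sum {A M ι : Type*} [AddCommMonoid A] [CommMonoid M] (ψ : AddChar A M)
    (s : Finset ι) (f : ι → A) : ψ (∑ i ∈ s, f i) = ∏ i ∈ s, ψ (f i) := by
  classical
  induction s using Finset.induction_on with
  | empty => simp
  | insert i s hi ih => rw [Finset.sum_insert hi, Finset.prod_insert hi, AddChar.map_add_eq_mul, ih]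

/-! ### One-dimensional Gauss sums in odd characteristic -/

section OddCharacteristic

variable {K : Type*} [Field K] [Fintype K] [DecidableEq K]

/-- An element y has χ(y) + 1 square roots, χ the quadratic character; the sum of the additive
character alone vanishes. -/
theorem sum_addChar_mul_sq {ψ : AddChar K ℂ} (hψ : ψ ≠ 1) (hK : ringChar K ≠ 2) (a : Kˣ) :
    ∑ x : K, ψ (a * (x * x)) =
      (quadraticChar K a : ℂ) * ∑ y : K, (quadraticChar K y : ℂ) * ψ y := by
  have h1 : ∑ x : K, ψ (a * (x * x)) = ∑ y : K, ((quadraticChar K y : ℂ) + 1) * ψ (a * y) := by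
    rw [← Finset.sum_fiberwise Finset.univ (fun x : K => x * x)]
    refine Finset.sum_congr rfl fun y _ => ?_
    rw [Finset.sum_congr rfl (g := fun _ => ψ (a * y))
      (fun x hx => by rw [(Finset.mem_filter.1 hx).2])]
    rw [Finset.sum_const, nsmul_eq_mul]
    congr 1
    have := quadraticChar_card_sqrts hK y
    have h2 : ({x | x ^ 2 = y} : Set K).toFinset = Finset.univ.filter (fun x : K => x * x = y) := by
      ext x
      simp [sq]
    rw [h2] at this
    exact_mod_cast this
  have h3 : ∑ y : K, ψ (a * y) = 0 := by
    refine (Equiv.sum_comp (Units.mulLeft a) (fun y => ψ y)).trans ?_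
    exact AddChar.sum_eq_zero_of_ne_one hψ
  simp_rw [h1, add_mul, one_mul, Finset.sum_add_distrib, h3, add_zero]
  rw [← Equiv.sum_comp (Units.mulLeft a) (fun y => (quadraticChar K y : ℂ) * ψ y),
    Finset.mul_sum]
  refine Finset.sum_congr rfl fun y _ => ?_
  have ha : (quadraticChar K (a : K)) * quadraticChar K (a : K) = 1 := by
    rw [← sq]
    exact quadraticChar_sq_one a.ne_zero
  have ha' : (quadraticChar K (a : K) : ℂ) * quadraticChar K (a : K) = 1 := by exact_mod_cast ha
  simp only [Units.mulLeft_apply, map_mul, Int.cast_mul]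
  linear_combination (-(quadraticChar K y : ℂ) * ψ (a * y)) * ha'

end OddCharacteristic

/-! ### The value of the Gauss sum in even dimension -/

section GaussSumValue

variable {K V : Type*} [Field K] [Fintype K] [AddCommGroup V] [Module K V] [Fintype V]

/-- After diagonalisation the sum is a product of 2m one-dimensional sums. Each contributes a factor
χ(t), and these signs cancel because their number is even. -/
theorem quadraticGaussSum_eq_one_of_odd {ψ : AddChar K ℂ} (hψ : ψ ≠ 1) {Q : QuadraticForm K V}
    (hQ : Q.polarBilin.Nondegenerate) {m : ℕ} (hV : Module.finrank K V = 2 * m)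
    (hK : ringChar K ≠ 2) {t : K} (ht : t ≠ 0) :
    quadraticGaussSum ψ Q t = quadraticGaussSum ψ Q 1 := by
  classical
  have h2 : (2 : K) ≠ 0 := Ring.two_ne_zero hK
  let _ : Invertible (2 : K) := invertibleOfNonzero h2
  have : FiniteDimensional K V := Module.Finite.of_finite
  obtain ⟨w, ⟨e⟩⟩ := QuadraticForm.equivalent_weightedSumSquares_units_of_nondegenerate' Q (by
    intro x hx
    apply hQ.1
    intro y
    rw [← QuadraticMap.two_nsmul_associated K Q, LinearMap.smul_apply, LinearMap.smul_apply]
    exact (congrArg (2 • ·) (hx y)).trans (smul_zero _))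
  have key : ∀ s : Kˣ, quadraticGaussSum ψ Q s =
      ∏ i, ((quadraticChar K (s * w i : K) : ℂ) * ∑ y : K, (quadraticChar K y : ℂ) * ψ y) := by
    intro s
    have h3 : ∀ i, (quadraticChar K (s * w i : K) : ℂ) * ∑ y : K, (quadraticChar K y : ℂ) * ψ y =
        ∑ x : K, ψ ((s * w i : K) * (x * x)) := by
      intro i
      have := sum_addChar_mul_sq hψ hK (s * w i)
      rw [Units.val_mul] at this
      exact this.symm
    simp_rw [h3, Fintype.prod_sum]
    unfold quadraticGaussSum
    rw [← Equiv.sum_comp e.toLinearEquiv.toEquiv]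
    refine Finset.sum_congr rfl fun x _ => ?_
    have h4 : Q x = QuadraticMap.weightedSumSquares K w (e x) := (e.map_app x).symm
    rw [h4, QuadraticMap.weightedSumSquares_apply, Finset.mul_sum]
    rw [addChar_map_sum]
    refine Finset.prod_congr rfl fun i _ => ?_
    congr 1
    rw [Units.smul_def, smul_eq_mul, mul_assoc]
    rfl
  have h5 := key (Units.mk0 t ht)
  have h6 := key 1
  simp only [Units.val_mk0, Units.val_one, one_mul, map_mul, Int.cast_mul, mul_assoc,
    Finset.prod_mul_distrib, Finset.prod_const, Finset.card_univ, Fintype.card_fin, hV] at h5 h6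
  have h7 : (quadraticChar K t : ℂ) ^ 2 = 1 := by exact_mod_cast quadraticChar_sq_one ht
  rw [h5, h6, pow_mul, h7, one_pow, one_mul]

theorem quadraticGaussSum_eq_one {ψ : AddChar K ℂ} (hψ : ψ ≠ 1) {Q : QuadraticForm K V}
    (hQ : Q.polarBilin.Nondegenerate) {m : ℕ} (hV : Module.finrank K V = 2 * m)
    {t : K} (ht : t ≠ 0) :
    quadraticGaussSum ψ Q t = quadraticGaussSum ψ Q 1 := by
  by_cases hK : ringChar K = 2
  -- In characteristic 2 every t is a square, and b² is absorbed by replacing x with bx.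
  · obtain ⟨b, rfl⟩ := FiniteField.isSquare_of_char_two hK t
    rw [← quadraticGaussSum_mul_sq ψ Q 1 (b := b) (by rintro rfl; simp at ht), mul_one]
  · exact quadraticGaussSum_eq_one_of_odd hψ hQ hV hK ht

/-- The Gauss sums of a nondegenerate quadratic form in even dimension `2 m` are `± q ^ m`, where
the sign is the type of the form. -/
theorem exists_sign_quadraticGaussSum {ψ : AddChar K ℂ} (hψ : ψ ≠ 1) {Q : QuadraticForm K V}
    (hQ : Q.polarBilin.Nondegenerate) {m : ℕ} (hV : Module.finrank K V = 2 * m) :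
    ∃ ε : ℤ, (ε = 1 ∨ ε = -1) ∧ ∀ t : K, t ≠ 0 →
      quadraticGaussSum ψ Q t = ε * (Fintype.card K : ℂ) ^ m := by
  have h1 := quadraticGaussSum_mul_neg hψ hQ (one_ne_zero (α := K))
  rw [quadraticGaussSum_eq_one hψ hQ hV (neg_ne_zero.2 one_ne_zero)] at h1
  rw [Module.card_eq_pow_finrank (K := K), hV] at h1
  have h2 : quadraticGaussSum ψ Q 1 ^ 2 = ((Fintype.card K : ℂ) ^ m) ^ 2 := by
    rw [sq, h1, ← pow_mul, mul_comm m]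
    push_cast
    rfl
  rcases sq_eq_sq_iff_eq_or_eq_neg.1 h2 with h | h
  · exact ⟨1, Or.inl rfl, fun t ht => by rw [quadraticGaussSum_eq_one hψ hQ hV ht, h]; simp⟩
  · exact ⟨-1, Or.inr rfl, fun t ht => by rw [quadraticGaussSum_eq_one hψ hQ hV ht, h]; simp⟩

end GaussSumValue

/-! ### Quadrics with prescribed pairings -/

section Counting

variable {K V E : Type*} [Field K] [Fintype K] [DecidableEq K] [AddCommGroup V] [Module K V]
  [Fintype V] [AddCommGroup E] [Module K E] [Fintype E]

theorem sum_addChar_mul {ψ : AddChar K ℂ} (hψ : ψ ≠ 1) (y : K) :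
    ∑ t, ψ (t * y) = if y = 0 then (Fintype.card K : ℂ) else 0 := by
  classical
  have h := sum_addChar_linearForm hψ (LinearMap.mulRight K y)
  simp only [LinearMap.mulRight_apply] at h
  rw [h]
  refine if_congr ⟨fun h0 => ?_, fun h0 => ?_⟩ rfl rfl
  · simpa using LinearMap.congr_fun h0 1
  · subst h0; simp

/-- The number of vectors `z` with `Q z = c` that have prescribed pairings with the vectors of the
image of an injective linear map `L`, in terms of a number of solutions in the source of `L`. -/
theorem card_affine_quadric {ψ : AddChar K ℂ} (hψ : ψ ≠ 1) {Q : QuadraticForm K V}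
    (hQ : Q.polarBilin.Nondegenerate) {g : ℤ}
    (hg : ∀ t : K, t ≠ 0 → quadraticGaussSum ψ Q t = g)
    (L : E →ₗ[K] V) (hL : Function.Injective L) (a : E →ₗ[K] K) (c : K) [DecidablePred fun z : V =>
      Q z = c ∧ ∀ s, QuadraticMap.polar Q z (L s) = a s] :
    ((Finset.univ.filter fun z : V =>
        Q z = c ∧ ∀ s, QuadraticMap.polar Q z (L s) = a s).card : ℤ) *
        (Fintype.card K * Fintype.card E) =
      Fintype.card V + g * (Fintype.card K *
        (Finset.univ.filter fun s : E => Q (L s) + a s + c = 0).card - Fintype.card E) := by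
  classical
  have hlin : ∀ z : V, ∑ s : E, ψ (QuadraticMap.polar Q z (L s) - a s) =
      if (∀ s, QuadraticMap.polar Q z (L s) = a s) then (Fintype.card E : ℂ) else 0 := by
    intro z
    have h := sum_addChar_linearForm hψ ((Q.polarBilin z).comp L - a)
    simp only [LinearMap.sub_apply, LinearMap.comp_apply,
      QuadraticMap.polarBilin_apply_apply] at h
    rw [h]
    refine if_congr ⟨fun h0 s => ?_, fun h0 => ?_⟩ rfl rfl
    · simpa [sub_eq_zero] using LinearMap.congr_fun h0 s
    · ext s
      simp [h0 s]
  have hLHS : ((Finset.univ.filter fun z : V =>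
        Q z = c ∧ ∀ s, QuadraticMap.polar Q z (L s) = a s).card : ℂ) *
        (Fintype.card K * Fintype.card E) =
      ∑ t : K, ∑ s : E, ∑ z : V, ψ (t * (Q z - c)) * ψ (QuadraticMap.polar Q z (L s) - a s) := by
    calc _ = ∑ z : V, (∑ t : K, ψ (t * (Q z - c))) *
          ∑ s : E, ψ (QuadraticMap.polar Q z (L s) - a s) := by
          rw [Finset.card_filter, Nat.cast_sum, Finset.sum_mul]
          refine Finset.sum_congr rfl fun z _ => ?_
          rw [sum_addChar_mul hψ, hlin]
          by_cases h1 : Q z = c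
          · by_cases h2 : ∀ s, QuadraticMap.polar Q z (L s) = a s
            · simp [h1, h2]
            · simp [h2]
          · simp [h1, sub_eq_zero]
      _ = _ := by
          simp_rw [Finset.sum_mul_sum]
          rw [Finset.sum_comm]
          refine Finset.sum_congr rfl fun t _ => ?_
          rw [Finset.sum_comm]
  -- The term t = 0: the sum over z kills every s ≠ 0, since L is injective and the polar form is
  -- nondegenerate.
  have hzero : ∑ s : E, ∑ z : V, ψ (0 * (Q z - c)) * ψ (QuadraticMap.polar Q z (L s) - a s) =
      Fintype.card V := by
    have h1 : ∀ s : E, ∑ z : V, ψ (0 * (Q z - c)) * ψ (QuadraticMap.polar Q z (L s) - a s) =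
        if s = 0 then (Fintype.card V : ℂ) else 0 := by
      intro s
      have h2 : ∀ z : V, ψ (0 * (Q z - c)) * ψ (QuadraticMap.polar Q z (L s) - a s) =
          ψ (Q.polarBilin (L s) z) * ψ (-a s) := by
        intro z
        rw [zero_mul, AddChar.map_zero_eq_one, one_mul, ← AddChar.map_add_eq_mul,
          QuadraticMap.polarBilin_apply_apply, QuadraticMap.polar_comm, sub_eq_add_neg]
      simp_rw [h2, ← Finset.sum_mul, sum_addChar_linearForm hψ]
      by_cases hs : s = 0
      · subst hs; simp
      · rw [if_neg, if_neg hs, zero_mul]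
        intro h0
        apply hs
        apply hL
        rw [map_zero]
        exact hQ.1 _ fun y => LinearMap.congr_fun h0 y
    simp_rw [h1]
    simp
  have hne : ∀ t : K, t ≠ 0 →
      ∑ s : E, ∑ z : V, ψ (t * (Q z - c)) * ψ (QuadraticMap.polar Q z (L s) - a s) =
        ∑ s : E, (g : ℂ) * ψ (t * -(Q (L s) + a s + c)) := by
    intro t ht
    -- Replacing s by ts brings out the factor t. Completing the square, Q(z) + (z, Ls) = Q(z + Ls)
    -- - Q(Ls), then leaves the Gauss sum of tQ.
    rw [← Equiv.sum_comp (LinearEquiv.smulOfNeZero K E t ht).toEquiv]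
    refine Finset.sum_congr rfl fun s _ => ?_
    rw [← hg t ht, quadraticGaussSum, 
      ← Equiv.sum_comp (Equiv.addRight (L s)) (fun z => ψ (t * Q z)), Finset.sum_mul]
    refine Finset.sum_congr rfl fun z _ => ?_
    rw [← AddChar.map_add_eq_mul, ← AddChar.map_add_eq_mul]
    congr 1
    have : QuadraticMap.polar Q z (L s) = Q (z + L s) - Q z - Q (L s) := rfl
    simp only [LinearEquiv.coe_toEquiv, LinearEquiv.smulOfNeZero_apply, map_smul,
      QuadraticMap.polar_smul_right, smul_eq_mul, Equiv.coe_addRight]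
    rw [this]
    ring
  have hall : ∑ t ∈ Finset.univ.erase (0 : K), ∑ s : E,
        (g : ℂ) * ψ (t * -(Q (L s) + a s + c)) =
      g * (Fintype.card K *
        (Finset.univ.filter fun s : E => Q (L s) + a s + c = 0).card - Fintype.card E) := by
    rw [Finset.sum_comm]
    simp_rw [← Finset.mul_sum]
    congr 1
    have h1 : ∀ s : E, ∑ t ∈ Finset.univ.erase (0 : K), ψ (t * -(Q (L s) + a s + c)) =
        (if Q (L s) + a s + c = 0 then (Fintype.card K : ℂ) else 0) - 1 := by
      intro s
      have h2 := sum_addChar_mul hψ (-(Q (L s) + a s + c))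
      rw [← Finset.add_sum_erase _ _ (Finset.mem_univ (0 : K))] at h2
      simp only [zero_mul, AddChar.map_zero_eq_one, neg_eq_zero] at h2
      rw [← h2]
      ring
    simp_rw [h1, Finset.sum_sub_distrib]
    rw [← Finset.sum_filter, Finset.sum_const, Finset.sum_const]
    simp [mul_comm]
  have final : ((Finset.univ.filter fun z : V =>
        Q z = c ∧ ∀ s, QuadraticMap.polar Q z (L s) = a s).card : ℂ) *
        (Fintype.card K * Fintype.card E) =
      Fintype.card V + g * (Fintype.card K *
        (Finset.univ.filter fun s : E => Q (L s) + a s + c = 0).card - Fintype.card E) := by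
    rw [hLHS, ← Finset.add_sum_erase _ _ (Finset.mem_univ (0 : K)), hzero, ← hall]
    congr 1
    exact Finset.sum_congr rfl fun t ht => hne t (Finset.ne_of_mem_erase ht)
  exact_mod_cast final

end Counting

/-! ### The finite check over the fields with 4 and 5 elements -/

section Conics

variable {R : Type*} [CommRing R] [Fintype R] [DecidableEq R]

/-- The number of points of an affine conic. -/
def conicCount (γ α β : R) : ℕ :=
  (Finset.univ.filter fun x : R × R =>
    x.1 * x.1 + γ * (x.1 * x.2) + x.2 * x.2 + (x.1 * α + x.2 * β) + 1 = 0).card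

/-- The number of roots of `s ^ 2 + α s + 1`. -/
def rootCount (α : R) : ℕ := (Finset.univ.filter fun s : R => s * s + s * α + 1 = 0).card

/-- The number of square roots of `t`. -/
def sqrtCount (t : R) : ℕ := (Finset.univ.filter fun α : R => α * α = t).card

/-- The total number of roots of the polynomials `s ^ 2 + α s + 1` with `α ^ 2 = t`. -/
def sqrtRootCount (t : R) : ℕ := ∑ α : R, if α * α = t then rootCount α else 0

/-- The total number of points of the conics with coefficients in the square roots of `A`. -/
def pairCount (A : Finset R) (γ : R) : ℕ :=
  ∑ α : R, ∑ β : R, if α * α ∈ A ∧ β * β ∈ A then conicCount γ α β else 0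

variable (R) in
/-- Sets of squares on which the valency is constant are separated from two classes of pairs by
the number of common neighbours. -/
def ConicsSeparate : Prop :=
  ∀ A : Finset R, A.Nonempty → (∀ t ∈ A, ∃ α, α * α = t) →
    (∀ t ∈ A, ∀ t' ∈ A, sqrtCount t = sqrtCount t' ∧ sqrtRootCount t = sqrtRootCount t' ∧
      (t = 4 ↔ t' = 4)) →
    ∃ γ γ' : R, γ * γ ∉ A ∧ γ' * γ' ∉ A ∧ pairCount A γ ≠ pairCount A γ'

theorem ConicsSeparate.of_ringEquiv {R' : Type*} [CommRing R'] [Fintype R'] [DecidableEq R']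
    (e : R ≃+* R') (h : ConicsSeparate R) : ConicsSeparate R' := by
  have hroot : ∀ α : R, rootCount (e α) = rootCount α := by
    intro α
    refine (Finset.card_equiv e.toEquiv fun s => ?_).symm
    simp only [Finset.mem_filter, Finset.mem_univ, true_and]
    rw [← e.map_eq_zero_iff]
    simp
  have hconic : ∀ γ α β : R, conicCount (e γ) (e α) (e β) = conicCount γ α β := by
    intro γ α β
    refine (Finset.card_equiv (e.toEquiv.prodCongr e.toEquiv) fun s => ?_).symm
    simp only [Finset.mem_filter, Finset.mem_univ, true_and]
    rw [← e.map_eq_zero_iff]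
    simp
  have hsq : ∀ α t : R, e α * e α = e t ↔ α * α = t := by
    intro α t
    rw [← map_mul, e.injective.eq_iff]
  have hsqrt : ∀ t : R, sqrtCount (e t) = sqrtCount t := by
    intro t
    refine (Finset.card_equiv e.toEquiv fun s => ?_).symm
    simp [hsq]
  have hsqrtRoot : ∀ t : R, sqrtRootCount (e t) = sqrtRootCount t := by
    intro t
    unfold sqrtRootCount
    rw [← Equiv.sum_comp e.toEquiv]
    refine Finset.sum_congr rfl fun α _ => ?_
    simp [hsq, hroot]
  have hpair : ∀ (A : Finset R) (γ : R), pairCount (A.map e.toEquiv.toEmbedding) (e γ) =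
      pairCount A γ := by
    intro A γ
    unfold pairCount
    rw [← Equiv.sum_comp e.toEquiv]
    refine Finset.sum_congr rfl fun α _ => ?_
    rw [← Equiv.sum_comp e.toEquiv]
    refine Finset.sum_congr rfl fun β _ => ?_
    simp [hconic]
  have hfour : ∀ t : R, e t = 4 ↔ t = 4 := by
    intro t
    rw [← e.injective.eq_iff (b := 4), map_ofNat]
  intro A' hne hs hc
  obtain ⟨A, rfl⟩ : ∃ A : Finset R, A' = A.map e.toEquiv.toEmbedding :=
    ⟨A'.map e.symm.toEquiv.toEmbedding, by ext; simp⟩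
  obtain ⟨γ, γ', h1, h2, h3⟩ := h A (by simpa using hne)
    (fun t ht => by
      obtain ⟨α, hα⟩ := hs (e t) (by simpa using ht)
      exact ⟨e.symm α, e.injective (by simpa using hα)⟩)
    (fun t ht t' ht' => by
      have := hc (e t) (by simpa using ht) (e t') (by simpa using ht')
      simpa only [hsqrt, hsqrtRoot, hfour] using this)
  refine ⟨e γ, e γ', ?_, ?_, ?_⟩
  · simpa [hsq] using h1
  · simpa [hsq] using h2
  · simpa only [hpair] using h3

/-- The field with four elements: `(a, b)` stands for `a + b ω`, where `ω ^ 2 = ω + 1`. -/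
def FourField : Type := ZMod 2 × ZMod 2

namespace FourField

instance : AddCommGroup FourField := inferInstanceAs (AddCommGroup (ZMod 2 × ZMod 2))
instance : Fintype FourField := inferInstanceAs (Fintype (ZMod 2 × ZMod 2))
instance : DecidableEq FourField := inferInstanceAs (DecidableEq (ZMod 2 × ZMod 2))
instance : Mul FourField :=
  ⟨fun x y => (x.1 * y.1 + x.2 * y.2, x.1 * y.2 + x.2 * y.1 + x.2 * y.2)⟩
instance : One FourField := ⟨(1, 0)⟩

instance : CommRing FourField where
  mul_assoc := by decide
  mul_comm := by decide
  one_mul := by decide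
  mul_one := by decide
  left_distrib := by decide
  right_distrib := by decide
  zero_mul := by decide
  mul_zero := by decide
  neg_add_cancel := by decide
  sub_eq_add_neg := by decide
  zsmul := zsmulRec
  nsmul := nsmulRec

theorem zmod_two_eq_or : ∀ c : ZMod 2, c = 0 ∨ c = 1 := by
  decide

/-- A field with four elements is isomorphic to `FourField`. -/
theorem nonempty_ringEquiv {K : Type*} [Field K] [Fintype K] (hK : Fintype.card K = 4) :
    Nonempty (FourField ≃+* K) := by
  classical
  have htwo : (2 : K) = 0 := by
    have h4 : ((4 : ℕ) : K) = 0 := by rw [← hK]; exact Nat.cast_card_eq_zero K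
    have : (2 : K) * 2 = 0 := by
      rw [← h4]
      norm_num
    simpa using this
  have : CharP K 2 := CharTwo.of_one_ne_zero_of_two_eq_zero one_ne_zero htwo
  obtain ⟨ω, hω⟩ : ∃ ω : K, ω ∉ ({0, 1} : Finset K) := by
    by_contra! h
    have h1 := Finset.card_le_card (fun x _ => h x : (Finset.univ : Finset K) ⊆ {0, 1})
    have h2 := Finset.card_le_two (a := (0 : K)) (b := 1)
    rw [Finset.card_univ, hK] at h1
    omega
  have h0 : ω ≠ 0 := fun h => hω (by simp [h])
  have h1 : ω ≠ 1 := fun h => hω (by simp [h])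
  have hq : ω * ω = ω + 1 := by
    have h3 : ω ^ 3 = 1 := by
      have := FiniteField.pow_card_sub_one_eq_one ω h0
      rwa [hK] at this
    -- Since ω³ - 1 = (ω - 1)(ω² + ω + 1), cancelling ω - 1 gives the minimal equation, up to signs
    -- in characteristic 2.
    apply mul_left_cancel₀ (sub_ne_zero.2 h1)
    linear_combination h3 - (ω * ω - 1) * htwo
  let i : ZMod 2 →+* K := ZMod.castHom dvd_rfl K
  let f : FourField →+* K :=
    { toFun := fun x => i x.1 + i x.2 * ω
      map_one' := by
        change i 1 + i 0 * ω = 1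
        simp
      map_zero' := by
        change i 0 + i 0 * ω = 0
        simp
      map_add' := fun x y => by
        change i (x.1 + y.1) + i (x.2 + y.2) * ω = _
        rw [map_add, map_add]
        ring
      map_mul' := fun x y => by
        change i (x.1 * y.1 + x.2 * y.2) + i (x.1 * y.2 + x.2 * y.1 + x.2 * y.2) * ω = _
        simp only [map_add, map_mul]
        linear_combination -(i x.2 * i y.2) * hq }
  have hf : Function.Injective f := by
    rw [injective_iff_map_eq_zero]
    intro x hx
    obtain ⟨a, b⟩ := x
    change i a + i b * ω = 0 at hx
    rcases zmod_two_eq_or a with rfl | rfl <;> rcases zmod_two_eq_or b with rfl | rfl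
    · rfl
    · simp [h0] at hx
    · simp at hx
    · rw [map_one, one_mul] at hx
      exact absurd (by linear_combination hx - htwo) h1
  exact ⟨RingEquiv.ofBijective f ((Fintype.bijective_iff_injective_and_card f).2
    ⟨hf, by rw [hK]; rfl⟩)⟩

end FourField

-- The admissible A are the singletons {0}, {1}, {4}: 0 has a single square root, and 4 is set apart
-- as the type of a point with itself.
set_option maxRecDepth 100000 in
theorem conicsSeparate_zmod_five : ConicsSeparate (ZMod 5) := by
  unfold ConicsSeparate
  decide +kernel

-- Here 4 = 0, and the root counts at 0, 1, ω, ω² are 1, 2, 0, 0. So the admissible A are the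
-- singletons and {ω, ω²}; the latter two types are exchanged by the field automorphism.
set_option maxRecDepth 100000 in
theorem conicsSeparate_fourField : ConicsSeparate FourField := by
  unfold ConicsSeparate
  decide +kernel

theorem conicsSeparate_of_card {K : Type*} [Field K] [Fintype K] [DecidableEq K]
    (hK : Fintype.card K = 4 ∨ Fintype.card K = 5) : ConicsSeparate K := by
  rcases hK with hK | hK
  · obtain ⟨e⟩ := FourField.nonempty_ringEquiv hK
    exact conicsSeparate_fourField.of_ringEquiv e
  · exact conicsSeparate_zmod_five.of_ringEquiv (ZMod.ringEquivOfPrime K Nat.prime_five hK)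

end Conics

/-! ### Solution counts and the existence of auxiliary vectors -/

section QuadricCounts

variable {K V : Type*} [Field K] [Fintype K] [DecidableEq K] [AddCommGroup V] [Module K V]
  [Fintype V]

/-- The numbers of solutions of `Q z = c` with up to two prescribed pairings, for a nondegenerate
form of type `ε` in dimension `2 m` over the field with `q` elements, where `Z = q ^ (m - 2)`. -/
structure QuadricCounts (Q : QuadraticForm K V) (q Z ε : ℤ) : Prop where
  card_field : (Fintype.card K : ℤ) = q
  sign : ε = 1 ∨ ε = -1
  quadric : ∀ c : K, c ≠ 0 →
    ((Finset.univ.filter fun z : V => Q z = c).card : ℤ) = Z ^ 2 * q ^ 3 - ε * Z * q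
  section_one : ∀ (v : V), v ≠ 0 → ∀ c α : K,
    ((Finset.univ.filter fun z : V => Q z = c ∧ QuadraticMap.polar Q z v = α).card : ℤ) =
      Z ^ 2 * q ^ 2 + ε * Z * q *
        ((Finset.univ.filter fun s : K => s * s * Q v + s * α + c = 0).card - 1)
  section_two : ∀ (v w : V), (∀ s r : K, s • v + r • w = 0 → s = 0 ∧ r = 0) → ∀ c α β : K,
    ((Finset.univ.filter fun z : V =>
      Q z = c ∧ QuadraticMap.polar Q z v = α ∧ QuadraticMap.polar Q z w = β).card : ℤ) =
      Z ^ 2 * q + ε * Z *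
        ((Finset.univ.filter fun x : K × K => x.1 * x.1 * Q v + x.1 * x.2 * QuadraticMap.polar Q v w
          + x.2 * x.2 * Q w + (x.1 * α + x.2 * β) + c = 0).card - q)

theorem exists_quadricCounts {Q : QuadraticForm K V} (hQ : Q.polarBilin.Nondegenerate) {m : ℕ}
    (hm : 2 ≤ m) (hV : Module.finrank K V = 2 * m) :
    ∃ ε : ℤ, QuadricCounts Q (Fintype.card K) ((Fintype.card K : ℤ) ^ (m - 2)) ε := by
  obtain ⟨ψ, hψ⟩ : ∃ ψ : AddChar K ℂ, ψ ≠ 1 := by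
    refine ⟨AddChar.FiniteField.primitiveChar_to_Complex K, ?_⟩
    have := AddChar.FiniteField.primitiveChar_to_Complex_isPrimitive K (a := 1) one_ne_zero
    simpa using this
  obtain ⟨ε, hε, hg⟩ := exists_sign_quadraticGaussSum hψ hQ hV
  obtain ⟨n, rfl⟩ : ∃ n, m = n + 2 := ⟨m - 2, by omega⟩
  have hq : (Fintype.card K : ℤ) ≠ 0 := by exact_mod_cast Fintype.card_ne_zero
  have hVcard : (Fintype.card V : ℤ) = ((Fintype.card K : ℤ) ^ n) ^ 2 * (Fintype.card K) ^ 4 := by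
    rw [Module.card_eq_pow_finrank (K := K), hV]
    push_cast
    ring
  have hg' : ∀ t : K, t ≠ 0 →
      quadraticGaussSum ψ Q t = (ε * (Fintype.card K : ℤ) ^ (n + 2) : ℤ) := by
    intro t ht
    rw [hg t ht]
    push_cast
    rfl
  refine ⟨ε, rfl, hε, ?_, ?_, ?_⟩
  · intro c hc
    -- The zero space as source imposes no pairing condition.
    have h := card_affine_quadric hψ hQ hg' (0 : PUnit →ₗ[K] V) (fun _ _ _ => rfl) 0 c
    simp [hc, hVcard] at h
    apply mul_right_cancel₀ hq
    rw [Nat.add_sub_cancel, h]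
    ring
  · intro v hv c α
    have h := card_affine_quadric hψ hQ hg' (LinearMap.toSpanSingleton K V v)
      (by
        rw [← LinearMap.ker_eq_bot, LinearMap.ker_toSpanSingleton K hv])
      (LinearMap.mulRight K α) c
    have h1 : ∀ z : V, (∀ s : K, QuadraticMap.polar Q z (LinearMap.toSpanSingleton K V v s) =
        LinearMap.mulRight K α s) ↔ QuadraticMap.polar Q z v = α := by
      intro z
      refine ⟨fun h => by simpa using h 1, fun h s => ?_⟩
      simp [h]
    simp_rw [h1] at h
    simp only [LinearMap.toSpanSingleton_apply, QuadraticMap.map_smul, smul_eq_mul,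
      LinearMap.mulRight_apply, hVcard] at h
    apply mul_right_cancel₀ (mul_ne_zero hq hq)
    rw [Nat.add_sub_cancel, h]
    ring
  · intro v w hvw c α β
    have h := card_affine_quadric hψ hQ hg'
      ((LinearMap.toSpanSingleton K V v).coprod (LinearMap.toSpanSingleton K V w))
      (by
        rw [injective_iff_map_eq_zero]
        rintro ⟨s, r⟩ hsr
        obtain ⟨rfl, rfl⟩ := hvw s r (by simpa using hsr)
        rfl)
      ((LinearMap.mulRight K α).coprod (LinearMap.mulRight K β)) c
    have h1 : ∀ z : V, (∀ s : K × K, QuadraticMap.polar Q z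
        ((LinearMap.toSpanSingleton K V v).coprod (LinearMap.toSpanSingleton K V w) s) =
        (LinearMap.mulRight K α).coprod (LinearMap.mulRight K β) s) ↔
        QuadraticMap.polar Q z v = α ∧ QuadraticMap.polar Q z w = β := by
      intro z
      refine ⟨fun h => ⟨by simpa using h (1, 0), by simpa using h (0, 1)⟩, fun h s => ?_⟩
      simp [h.1, h.2, QuadraticMap.polar_add_right]
    have h2 : ∀ s r : K, Q (s • v + r • w) =
        s * s * Q v + s * r * QuadraticMap.polar Q v w + r * r * Q w := by
      intro s r
      rw [QuadraticMap.map_add Q]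
      simp only [QuadraticMap.map_smul, QuadraticMap.polar_smul_left,
        QuadraticMap.polar_smul_right, smul_eq_mul]
      ring
    simp_rw [h1] at h
    simp only [LinearMap.coprod_apply, LinearMap.toSpanSingleton_apply, h2,
      LinearMap.mulRight_apply, hVcard, Fintype.card_prod, Nat.cast_mul] at h
    apply mul_right_cancel₀ (mul_ne_zero hq (mul_ne_zero hq hq))
    rw [Nat.add_sub_cancel, h]
    ring

namespace QuadricCounts

variable {Q : QuadraticForm K V} {q Z ε : ℤ}

theorem exists_orthogonal_one (h : QuadricCounts Q q Z ε) (hq : 4 ≤ q) (hZ : q ≤ Z) {v : V}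
    (hv : v ≠ 0) (d : K) : ∃ u, Q u = d ∧ QuadraticMap.polar Q u v = 0 := by
  have h1 := h.section_one v hv d 0
  have h2 : ((Finset.univ.filter fun s : K => s * s * Q v + s * 0 + d = 0).card : ℤ) ≤ q := by
    rw [← h.card_field]
    exact_mod_cast Finset.card_le_univ _
  have h3 : (0 : ℤ) ≤ (Finset.univ.filter fun s : K => s * s * Q v + s * 0 + d = 0).card :=
    Nat.cast_nonneg _
  generalize ((Finset.univ.filter fun s : K => s * s * Q v + s * 0 + d = 0).card : ℤ) = M at *
  have h4 : 0 < Z * q * (Z * q + ε * (M - 1)) := by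
    have hq0 : 0 < q := by linarith
    have hZ0 : 0 < Z := by linarith
    apply mul_pos (by positivity)
    rcases h.sign with rfl | rfl <;> nlinarith
  have h5 : 0 < (Finset.univ.filter
      fun z : V => Q z = d ∧ QuadraticMap.polar Q z v = 0).card := by
    have : Z ^ 2 * q ^ 2 + ε * Z * q * (M - 1) = Z * q * (Z * q + ε * (M - 1)) := by ring
    rw [this] at h1
    exact_mod_cast h1 ▸ h4
  obtain ⟨u, hu⟩ := Finset.card_pos.1 h5
  exact ⟨u, (Finset.mem_filter.1 hu).2⟩

theorem exists_orthogonal_two (h : QuadricCounts Q q Z ε) (hq : 4 ≤ q) (hZ : q ≤ Z) {v w : V}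
    (hvw : ∀ s r : K, s • v + r • w = 0 → s = 0 ∧ r = 0) (d : K) :
    ∃ u, Q u = d ∧ QuadraticMap.polar Q u v = 0 ∧ QuadraticMap.polar Q u w = 0 := by
  have h1 := h.section_two v w hvw d 0 0
  set M := (Finset.univ.filter fun x : K × K => x.1 * x.1 * Q v +
    x.1 * x.2 * QuadraticMap.polar Q v w + x.2 * x.2 * Q w + (x.1 * 0 + x.2 * 0) + d = 0).card
  have h2 : (M : ℤ) ≤ q * q := by
    rw [← h.card_field]
    have : M ≤ Fintype.card (K × K) := Finset.card_le_univ _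
    rw [Fintype.card_prod] at this
    exact_mod_cast this
  have h3 : (0 : ℤ) ≤ M := Nat.cast_nonneg _
  have h4 : 0 < Z * (Z * q + ε * (M - q)) := by
    have hq0 : 0 < q := by linarith
    have hZ0 : 0 < Z := by linarith
    apply mul_pos (by positivity)
    rcases h.sign with rfl | rfl <;> nlinarith
  have h5 : 0 < (Finset.univ.filter fun z : V =>
      Q z = d ∧ QuadraticMap.polar Q z v = 0 ∧ QuadraticMap.polar Q z w = 0).card := by
    have : Z ^ 2 * q + ε * Z * (M - q) = Z * (Z * q + ε * (M - q)) := by ring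
    rw [this] at h1
    exact_mod_cast h1 ▸ h4
  obtain ⟨u, hu⟩ := Finset.card_pos.1 h5
  exact ⟨u, (Finset.mem_filter.1 hu).2⟩

/-- Union bound: the whole quadric has about Z²q³ points, and each of the two excluded sections only
about Z²q². -/
theorem exists_polar_ne_ne (h : QuadricCounts Q q Z ε) (hq : 4 ≤ q) (hZ : q ≤ Z) {v w : V}
    (hv : v ≠ 0) (hw : w ≠ 0) {c : K} (hc : c ≠ 0) (d : K) :
    ∃ z, Q z = c ∧ QuadraticMap.polar Q z v ≠ d ∧ QuadraticMap.polar Q z w ≠ d := by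
  classical
  by_contra! hcon
  have hsub : (Finset.univ.filter fun z : V => Q z = c) ⊆
      (Finset.univ.filter fun z : V => Q z = c ∧ QuadraticMap.polar Q z v = d) ∪
      (Finset.univ.filter fun z : V => Q z = c ∧ QuadraticMap.polar Q z w = d) := by
    intro z hz
    simp only [Finset.mem_union, Finset.mem_filter, Finset.mem_univ, true_and] at hz ⊢
    by_cases hzv : QuadraticMap.polar Q z v = d
    · exact Or.inl ⟨hz, hzv⟩
    · exact Or.inr ⟨hz, hcon z hz hzv⟩
  have hle := (Finset.card_le_card hsub).trans (Finset.card_union_le _ _)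
  have hle' : ((Finset.univ.filter fun z : V => Q z = c).card : ℤ) ≤
      (Finset.univ.filter fun z : V => Q z = c ∧ QuadraticMap.polar Q z v = d).card +
      (Finset.univ.filter fun z : V => Q z = c ∧ QuadraticMap.polar Q z w = d).card := by
    exact_mod_cast hle
  rw [h.quadric c hc, h.section_one v hv, h.section_one w hw] at hle'
  have hM : ∀ v : V, ((Finset.univ.filter fun s : K => s * s * Q v + s * d + c = 0).card : ℤ) ≤
      q := by
    intro v
    rw [← h.card_field]
    exact_mod_cast Finset.card_le_univ _
  have h2 := hM v
  have h2' := hM w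
  have h3 : (0 : ℤ) ≤ (Finset.univ.filter fun s : K => s * s * Q v + s * d + c = 0).card :=
    Nat.cast_nonneg _
  have h3' : (0 : ℤ) ≤ (Finset.univ.filter fun s : K => s * s * Q w + s * d + c = 0).card :=
    Nat.cast_nonneg _
  generalize ((Finset.univ.filter fun s : K => s * s * Q v + s * d + c = 0).card : ℤ) = M at *
  generalize ((Finset.univ.filter fun s : K => s * s * Q w + s * d + c = 0).card : ℤ) = M' at *
  have h4 : 0 < Z * q * (Z * q * (q - 2) - ε * (M + M' - 1)) := by
    have hq0 : 0 < q := by linarith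
    have hZ0 : 0 < Z := by linarith
    apply mul_pos (by positivity)
    have h5 : 4 * q ≤ Z * q := by nlinarith
    have h6 : Z * q * 2 ≤ Z * q * (q - 2) := by nlinarith
    rcases h.sign with rfl | rfl <;> linarith
  have h7 : Z * q * (Z * q * (q - 2) - ε * (M + M' - 1)) = Z ^ 2 * q ^ 3 - ε * Z * q -
    (Z ^ 2 * q ^ 2 + ε * Z * q * (M - 1) + (Z ^ 2 * q ^ 2 + ε * Z * q * (M' - 1))) := by ring
  linarith

/-- The inequality behind the union bound in `exists_polar_eq_ne_ne`: the main terms are 2Z²q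
against Z²q², and q ≥ 4 with Z ≥ q lets the gap absorb the errors. -/
theorem section_two_add_lt_section_one {q Z ε M N N' : ℤ} (hε : ε = 1 ∨ ε = -1) (hq : 4 ≤ q)
    (hZ : q ≤ Z) (h0 : 0 ≤ M) (hM : M ≤ q) (h1 : 0 ≤ N) (hN : N ≤ q * q) (h2 : 0 ≤ N')
    (hN' : N' ≤ q * q) :
    (Z ^ 2 * q + ε * Z * (N - q)) + (Z ^ 2 * q + ε * Z * (N' - q)) <
      Z ^ 2 * q ^ 2 + ε * Z * q * (M - 1) := by
  have h4 : 0 < Z * (Z * q * (q - 2) + ε * (q * M + q - N - N')) := by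
    have hq0 : 0 < q := by linarith
    have hZ0 : 0 < Z := by linarith
    apply mul_pos hZ0
    have h5 : q * q ≤ Z * q := by gcongr
    have h6 : Z * q * 2 ≤ Z * q * (q - 2) := by
      apply mul_le_mul_of_nonneg_left (by linarith) (by positivity)
    have h7 : q * M ≤ q * q := by gcongr
    have h8 : 0 ≤ q * M := mul_nonneg hq0.le h0
    have h9 : 4 * q ≤ q * q := by gcongr
    generalize Z * q * (q - 2) = A at *
    generalize q * M = B at *
    generalize q * q = C at *
    rcases hε with rfl | rfl <;> linarith
  have h7 : Z * (Z * q * (q - 2) + ε * (q * M + q - N - N')) =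
    Z ^ 2 * q ^ 2 + ε * Z * q * (M - 1) -
      (Z ^ 2 * q + ε * Z * (N - q) + (Z ^ 2 * q + ε * Z * (N' - q))) := by ring
  linarith

theorem exists_polar_eq_ne_ne (h : QuadricCounts Q q Z ε) (hq : 4 ≤ q) (hZ : q ≤ Z) {v w w' : V}
    (hvw : ∀ s r : K, s • v + r • w = 0 → s = 0 ∧ r = 0)
    (hvw' : ∀ s r : K, s • v + r • w' = 0 → s = 0 ∧ r = 0) (c α d : K) :
    ∃ z, Q z = c ∧ QuadraticMap.polar Q z v = α ∧ QuadraticMap.polar Q z w ≠ d ∧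
      QuadraticMap.polar Q z w' ≠ d := by
  have hv : v ≠ 0 := by
    rintro rfl
    exact one_ne_zero (hvw 1 0 (by simp)).1
  classical
  by_contra! hcon
  have hsub : (Finset.univ.filter fun z : V => Q z = c ∧ QuadraticMap.polar Q z v = α) ⊆
      (Finset.univ.filter fun z : V => Q z = c ∧ QuadraticMap.polar Q z v = α ∧
        QuadraticMap.polar Q z w = d) ∪
      (Finset.univ.filter fun z : V => Q z = c ∧ QuadraticMap.polar Q z v = α ∧
        QuadraticMap.polar Q z w' = d) := by
    intro z hz
    simp only [Finset.mem_union, Finset.mem_filter, Finset.mem_univ, true_and] at hz ⊢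
    by_cases hzv : QuadraticMap.polar Q z w = d
    · exact Or.inl ⟨hz.1, hz.2, hzv⟩
    · exact Or.inr ⟨hz.1, hz.2, hcon z hz.1 hz.2 hzv⟩
  have hle := (Finset.card_le_card hsub).trans (Finset.card_union_le _ _)
  zify at hle
  rw [h.section_one v hv, h.section_two v w hvw, h.section_two v w' hvw'] at hle
  set M := (Finset.univ.filter fun s : K => s * s * Q v + s * α + c = 0).card
  set N := (Finset.univ.filter fun x : K × K => x.1 * x.1 * Q v +
    x.1 * x.2 * QuadraticMap.polar Q v w + x.2 * x.2 * Q w + (x.1 * α + x.2 * d) + c = 0).card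
  set N' := (Finset.univ.filter fun x : K × K => x.1 * x.1 * Q v +
    x.1 * x.2 * QuadraticMap.polar Q v w' + x.2 * x.2 * Q w' + (x.1 * α + x.2 * d) + c = 0).card
  have hM : (M : ℤ) ≤ q := by
    rw [← h.card_field]
    exact_mod_cast Finset.card_le_univ _
  have hN : (N : ℤ) ≤ q * q := by
    rw [← h.card_field]
    have : N ≤ Fintype.card (K × K) := Finset.card_le_univ _
    rw [Fintype.card_prod] at this
    exact_mod_cast this
  have hN' : (N' : ℤ) ≤ q * q := by
    rw [← h.card_field]
    have : N' ≤ Fintype.card (K × K) := Finset.card_le_univ _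
    rw [Fintype.card_prod] at this
    exact_mod_cast this
  have h0 : (0 : ℤ) ≤ M := Nat.cast_nonneg _
  have h1 : (0 : ℤ) ≤ N := Nat.cast_nonneg _
  have h2 : (0 : ℤ) ≤ N' := Nat.cast_nonneg _
  exact absurd hle
    (not_le.2 (section_two_add_lt_section_one h.sign hq hZ h0 hM h1 hN h2 hN'))

end QuadricCounts

end QuadricCounts

/-! ### Reflections and the derived subgroup -/

section Reflections

variable {K V : Type*} [Field K] [AddCommGroup V] [Module K V]

theorem mem_isometryGroup {Q : QuadraticForm K V} {g : V ≃ₗ[K] V} :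
    g ∈ isometryGroup Q ↔ ∀ v, Q (g v) = Q v := Iff.rfl

theorem polar_isometry {Q : QuadraticForm K V} {g : V ≃ₗ[K] V} (hg : g ∈ isometryGroup Q)
    (x y : V) : QuadraticMap.polar Q (g x) (g y) = QuadraticMap.polar Q x y := by
  simp only [QuadraticMap.polar, ← map_add, mem_isometryGroup.1 hg]

theorem omegaGroup_le_isometryGroup (Q : QuadraticForm K V) : omegaGroup Q ≤ isometryGroup Q := by
  rw [omegaGroup, Subgroup.commutator_le]
  intro g hg h hh
  exact mul_mem (mul_mem (mul_mem hg hh) (inv_mem hg)) (inv_mem hh)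

theorem inv_mul_polarBilin_self (Q : QuadraticForm K V) {u : V} (hu : Q u ≠ 0) :
    ((Q u)⁻¹ • Q.polarBilin u) u = 2 := by
  rw [LinearMap.smul_apply, QuadraticMap.polarBilin_apply_apply, QuadraticMap.polar_self,
    smul_eq_mul, two_nsmul]
  field_simp
  norm_num

/-- The reflection in a nonsingular vector. -/
noncomputable def quadraticReflection (Q : QuadraticForm K V) {u : V} (hu : Q u ≠ 0) :
    V ≃ₗ[K] V :=
  Module.reflection (inv_mul_polarBilin_self Q hu)

variable {Q : QuadraticForm K V}

theorem quadraticReflection_apply {u : V} (hu : Q u ≠ 0) (x : V) :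
    quadraticReflection Q hu x = x - ((Q u)⁻¹ * QuadraticMap.polar Q u x) • u := by
  rw [quadraticReflection, Module.reflection_apply]
  rfl

theorem quadraticReflection_mem {u : V} (hu : Q u ≠ 0) :
    quadraticReflection Q hu ∈ isometryGroup Q := by
  intro x
  rw [quadraticReflection_apply, sub_eq_add_neg, QuadraticMap.map_add Q, QuadraticMap.map_neg,
    QuadraticMap.polar_neg_right, QuadraticMap.map_smul, QuadraticMap.polar_smul_right,
    QuadraticMap.polar_comm Q x u]
  simp only [smul_eq_mul]
  field_simp
  ring

theorem quadraticReflection_apply_of_polar_eq_zero {u : V} (hu : Q u ≠ 0) {x : V}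
    (hx : QuadraticMap.polar Q u x = 0) : quadraticReflection Q hu x = x := by
  rw [quadraticReflection_apply, hx, mul_zero, zero_smul, sub_zero]

theorem map_sub_of_map_eq {x y : V} {c : K} (hx : Q x = c) (hy : Q y = c) :
    Q (x - y) = 2 * c - QuadraticMap.polar Q x y := by
  rw [sub_eq_add_neg, QuadraticMap.map_add Q, QuadraticMap.map_neg, QuadraticMap.polar_neg_right,
    hx, hy]
  ring

theorem quadraticReflection_sub_apply {x y : V} (hxy : Q x = Q y) (h : Q (x - y) ≠ 0) :
    quadraticReflection Q h x = y := by
  have h1 : QuadraticMap.polar Q (x - y) x = Q (x - y) := by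
    rw [map_sub_of_map_eq hxy rfl, QuadraticMap.polar_sub_left, QuadraticMap.polar_self, hxy,
      QuadraticMap.polar_comm Q y x, two_nsmul]
    ring
  rw [quadraticReflection_apply, h1, inv_mul_cancel₀ h, one_smul, sub_sub_cancel]

theorem quadraticReflection_conj {u : V} (hu : Q u ≠ 0) {g : V ≃ₗ[K] V}
    (hg : g ∈ isometryGroup Q) (hgu : Q (g u) ≠ 0) :
    g * quadraticReflection Q hu * g⁻¹ = quadraticReflection Q hgu := by
  rw [mul_inv_eq_iff_eq_mul]
  ext x
  rw [LinearEquiv.mul_apply, LinearEquiv.mul_apply, quadraticReflection_apply,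
    quadraticReflection_apply, map_sub, map_smul, polar_isometry hg, mem_isometryGroup.1 hg]

theorem quadraticReflection_mul_self {u : V} (hu : Q u ≠ 0) :
    quadraticReflection Q hu * quadraticReflection Q hu = 1 :=
  LinearEquiv.ext fun x => Module.involutive_reflection (inv_mul_polarBilin_self Q hu) x

theorem quadraticReflection_inv {u : V} (hu : Q u ≠ 0) :
    (quadraticReflection Q hu)⁻¹ = quadraticReflection Q hu :=
  inv_eq_of_mul_eq_one_left (quadraticReflection_mul_self hu)

/-- If g maps u to u', it conjugates one reflection into the other, and the product of the two is
the commutator of the first with g. -/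
theorem quadraticReflection_mul_mem_omegaGroup {u u' : V} (hu : Q u ≠ 0) (hu' : Q u' ≠ 0)
    {g : V ≃ₗ[K] V} (hg : g ∈ isometryGroup Q) (hgu : g u = u') :
    quadraticReflection Q hu * quadraticReflection Q hu' ∈ omegaGroup Q := by
  subst hgu
  have h := Subgroup.commutator_mem_commutator (quadraticReflection_mem hu) hg
  rw [commutatorElement_def, quadraticReflection_inv hu, mul_assoc, mul_assoc,
    ← mul_assoc g, quadraticReflection_conj hu hg hu'] at h
  exact h

theorem eq_zero_of_smul_add_smul_eq_zero {v w : V} (hv : Q v = 1) (hw : Q w = 1) (hne : w ≠ v)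
    (hne' : w ≠ -v) (s r : K) (h : s • v + r • w = 0) : s = 0 ∧ r = 0 := by
  have h1 : s • v = -(r • w) := eq_neg_of_add_eq_zero_left h
  have h2 : s * s = r * r := by
    have := congrArg Q h1
    rw [QuadraticMap.map_neg, QuadraticMap.map_smul, QuadraticMap.map_smul, hv, hw] at this
    simpa using this
  by_cases hr : r = 0
  · subst hr
    simpa using h2
  · exfalso
    rcases mul_self_eq_mul_self_iff.1 h2 with rfl | rfl
    · apply hne'
      rw [← smul_neg] at h1
      rw [smul_right_injective V hr h1, neg_neg]
    · apply hne
      rw [neg_smul, neg_inj] at h1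
      exact (smul_right_injective V hr h1).symm

end Reflections

/-! ### Transitivity of Ω on vectors and pairs of vectors -/

section Transitivity

variable {K V : Type*} [Field K] [Fintype K] [DecidableEq K] [AddCommGroup V] [Module K V]
  [Fintype V] {Q : QuadraticForm K V} {q Z ε : ℤ}

namespace QuadricCounts

theorem exists_isometry (h : QuadricCounts Q q Z ε) (hq : 4 ≤ q) (hZ : q ≤ Z) {u u' : V} {c : K}
    (hc : c ≠ 0) (hu : Q u = c) (hu' : Q u' = c) : ∃ g ∈ isometryGroup Q, g u = u' := by
  have hu0 : u ≠ 0 := by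
    rintro rfl
    exact hc (by rw [← hu, QuadraticMap.map_zero])
  have hu0' : u' ≠ 0 := by
    rintro rfl
    exact hc (by rw [← hu', QuadraticMap.map_zero])
  -- For vectors of norm c, Q(u - z) = 2c - (u, z). Avoiding the pairing 2c makes both differences
  -- nonsingular, so two reflections lead from u through z to u'.
  obtain ⟨z, hz, hzu, hzu'⟩ := h.exists_polar_ne_ne hq hZ hu0 hu0' hc (2 * c)
  have h1 : Q (u - z) ≠ 0 := by
    rw [map_sub_of_map_eq hu hz, QuadraticMap.polar_comm]
    exact sub_ne_zero.2 hzu.symm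
  have h2 : Q (z - u') ≠ 0 := by
    rw [map_sub_of_map_eq hz hu']
    exact sub_ne_zero.2 hzu'.symm
  refine ⟨quadraticReflection Q h2 * quadraticReflection Q h1,
    mul_mem (quadraticReflection_mem h2) (quadraticReflection_mem h1), ?_⟩
  rw [LinearEquiv.mul_apply, quadraticReflection_sub_apply (hu.trans hz.symm),
    quadraticReflection_sub_apply (hz.trans hu'.symm)]

/-- Two vectors of the same norm with nonsingular difference are related by an element of
`Ω(V, Q)` that fixes prescribed vectors. -/
theorem exists_omega_of_map_sub_ne_zero (h : QuadricCounts Q q Z ε) (hq : 4 ≤ q) (hZ : q ≤ Z)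
    {w w' u : V} (hw : Q w = Q w') (hs : Q (w - w') ≠ 0) (hu : Q u = Q (w - w'))
    (huw : QuadraticMap.polar Q u w' = 0) :
    ∃ g ∈ omegaGroup Q, g w = w' ∧ ∀ x, QuadraticMap.polar Q u x = 0 →
      QuadraticMap.polar Q w x = QuadraticMap.polar Q w' x → g x = x := by
  have hu0 : Q u ≠ 0 := hu ▸ hs
  obtain ⟨k, hk, hku⟩ := h.exists_isometry hq hZ hs hu rfl
  -- The reflection in w - w' moves w to w'. The reflection in u, of the same norm and orthogonal to
  -- w', corrects it to an element of Ω without moving w'.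
  refine ⟨quadraticReflection Q hu0 * quadraticReflection Q hs,
    quadraticReflection_mul_mem_omegaGroup hu0 hs hk hku, ?_, fun x hx hwx => ?_⟩
  · rw [LinearEquiv.mul_apply, quadraticReflection_sub_apply hw,
      quadraticReflection_apply_of_polar_eq_zero hu0 huw]
  · rw [LinearEquiv.mul_apply, quadraticReflection_apply_of_polar_eq_zero hs,
      quadraticReflection_apply_of_polar_eq_zero hu0 hx]
    rw [QuadraticMap.polar_sub_left, hwx, sub_self]

theorem exists_omega (h : QuadricCounts Q q Z ε) (hq : 4 ≤ q) (hZ : q ≤ Z) {v v' : V}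
    (hv : Q v = 1) (hv' : Q v' = 1) : ∃ g ∈ omegaGroup Q, g v = v' := by
  have hne : ∀ x : V, Q x = 1 → x ≠ 0 := by
    rintro x hx rfl
    exact one_ne_zero (hx.symm.trans (QuadraticMap.map_zero Q))
  obtain ⟨z, hz, hzv, hzv'⟩ := h.exists_polar_ne_ne hq hZ (hne v hv) (hne v' hv')
    (one_ne_zero (α := K)) 2
  have h1 : Q (v - z) ≠ 0 := by
    rw [map_sub_of_map_eq hv hz, QuadraticMap.polar_comm, mul_one]
    exact sub_ne_zero.2 hzv.symm
  have h2 : Q (z - v') ≠ 0 := by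
    rw [map_sub_of_map_eq hz hv', mul_one]
    exact sub_ne_zero.2 hzv'.symm
  obtain ⟨u, hu, huz⟩ := h.exists_orthogonal_one hq hZ (hne z hz) (Q (v - z))
  obtain ⟨u', hu', huv'⟩ := h.exists_orthogonal_one hq hZ (hne v' hv') (Q (z - v'))
  obtain ⟨g, hg, hgv, -⟩ := h.exists_omega_of_map_sub_ne_zero hq hZ (hv.trans hz.symm) h1 hu huz
  obtain ⟨g', hg', hgz, -⟩ :=
    h.exists_omega_of_map_sub_ne_zero hq hZ (hz.trans hv'.symm) h2 hu' huv'
  exact ⟨g' * g, mul_mem hg' hg, by rw [LinearEquiv.mul_apply, hgv, hgz]⟩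

/-- Both w and w' are joined to a vector z of norm 1 having the same pairing with v, so that z - w
and z - w' are orthogonal to v. The correcting vectors are chosen orthogonal to v too, so every
reflection used fixes v. -/
theorem exists_omega_fixing (h : QuadricCounts Q q Z ε) (hq : 4 ≤ q) (hZ : q ≤ Z) {v w w' : V}
    (hw : Q w = 1) (hw' : Q w' = 1)
    (hvw : ∀ s r : K, s • v + r • w = 0 → s = 0 ∧ r = 0)
    (hvw' : ∀ s r : K, s • v + r • w' = 0 → s = 0 ∧ r = 0)
    (hp : QuadraticMap.polar Q w v = QuadraticMap.polar Q w' v) :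
    ∃ g ∈ omegaGroup Q, g v = v ∧ g w = w' := by
  obtain ⟨z, hz, hzv, hzw, hzw'⟩ := h.exists_polar_eq_ne_ne hq hZ hvw hvw' 1
    (QuadraticMap.polar Q w v) 2
  have h1 : Q (z - w) ≠ 0 := by
    rw [map_sub_of_map_eq hz hw, mul_one]
    exact sub_ne_zero.2 hzw.symm
  have h2 : Q (z - w') ≠ 0 := by
    rw [map_sub_of_map_eq hz hw', mul_one]
    exact sub_ne_zero.2 hzw'.symm
  obtain ⟨u, hu, huv, huw⟩ := h.exists_orthogonal_two hq hZ hvw (Q (z - w))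
  obtain ⟨u', hu', huv', huw'⟩ := h.exists_orthogonal_two hq hZ hvw' (Q (z - w'))
  obtain ⟨g, hg, hgz, hgv⟩ := h.exists_omega_of_map_sub_ne_zero hq hZ (hz.trans hw.symm) h1 hu huw
  obtain ⟨g', hg', hgz', hgv'⟩ :=
    h.exists_omega_of_map_sub_ne_zero hq hZ (hz.trans hw'.symm) h2 hu' huw'
  have hgi : ∀ x y, g x = y → g⁻¹ y = x := by
    rintro x y rfl
    rw [← LinearEquiv.mul_apply, inv_mul_cancel, LinearEquiv.coe_one, id]
  refine ⟨g' * g⁻¹, mul_mem hg' (inv_mem hg), ?_, ?_⟩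
  · rw [LinearEquiv.mul_apply, hgi v v (hgv v huv hzv), hgv' v huv' (hzv.trans hp)]
  · rw [LinearEquiv.mul_apply, hgi z w hgz, hgz']

end QuadricCounts

end Transitivity

/-! ### Points as pairs ±z of vectors of norm 1 -/

section UnitPoints

variable {K V X : Type*} [Field K] [AddCommGroup V] [Module K V]

/-- `rep` identifies `X` with the set of pairs `± z` with `Q z = 1`. -/
structure IsUnitRepresentative (Q : QuadraticForm K V) (rep : X → V) : Prop where
  map_eq_one : ∀ x, Q (rep x) = 1
  exists_eq_or_eq_neg : ∀ z, Q z = 1 → ∃ x, z = rep x ∨ z = -rep x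
  eq_of_eq_or_eq_neg : ∀ x y, rep x = rep y ∨ rep x = -rep y → x = y

/-- The invariant of a pair of points that separates the orbits of `Ω(V, Q)`. -/
def pairType (Q : QuadraticForm K V) (rep : X → V) (x y : X) : K :=
  QuadraticMap.polar Q (rep x) (rep y) * QuadraticMap.polar Q (rep x) (rep y)

theorem pairType_comm (Q : QuadraticForm K V) (rep : X → V) (x y : X) :
    pairType Q rep x y = pairType Q rep y x := by
  rw [pairType, pairType, QuadraticMap.polar_comm]

theorem card_pair_neg [DecidableEq K] [DecidableEq V] {v : V} (hv : v ≠ 0) :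
    ({v, -v} : Finset V).card = ({1, -1} : Finset K).card := by
  rw [← Finset.card_image_of_injective ({1, -1} : Finset K) (smul_left_injective K hv)]
  simp [Finset.image_insert]

namespace IsUnitRepresentative

variable {Q : QuadraticForm K V} {rep : X → V}

theorem ne_zero (h : IsUnitRepresentative Q rep) (x : X) : rep x ≠ 0 := by
  intro h0
  have := h.map_eq_one x
  rw [h0, QuadraticMap.map_zero] at this
  exact zero_ne_one this

theorem pairType_self (h : IsUnitRepresentative Q rep) (x : X) : pairType Q rep x x = 4 := by
  rw [pairType, QuadraticMap.polar_self, h.map_eq_one, two_nsmul]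
  norm_num

variable [Fintype V] [DecidableEq K]

/-- Writing the size of {z, -z} as that of {1, -1} treats characteristic 2, where it is 1, together
with odd characteristic. -/
theorem card_mul_card [Fintype X] (h : IsUnitRepresentative Q rep) (P : V → Prop) [DecidablePred P]
    (hP : ∀ z, P (-z) ↔ P z) :
    ({1, -1} : Finset K).card * (Finset.univ.filter fun x => P (rep x)).card =
      (Finset.univ.filter fun z => Q z = 1 ∧ P z).card := by
  classical
  have h1 : (Finset.univ.filter fun z => Q z = 1 ∧ P z) =
      (Finset.univ.filter fun x => P (rep x)).biUnion fun x => {rep x, -rep x} := by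
    ext z
    simp only [Finset.mem_filter, Finset.mem_univ, true_and, Finset.mem_biUnion,
      Finset.mem_insert, Finset.mem_singleton]
    constructor
    · rintro ⟨hz, hPz⟩
      obtain ⟨x, rfl | rfl⟩ := h.exists_eq_or_eq_neg z hz
      · exact ⟨x, hPz, Or.inl rfl⟩
      · exact ⟨x, (hP _).1 hPz, Or.inr rfl⟩
    · rintro ⟨x, hx, rfl | rfl⟩
      · exact ⟨h.map_eq_one x, hx⟩
      · exact ⟨by rw [QuadraticMap.map_neg, h.map_eq_one], (hP _).2 hx⟩
  rw [h1, Finset.card_biUnion, 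
    Finset.sum_congr rfl fun x _ => card_pair_neg (K := K) (h.ne_zero x),
    Finset.sum_const, smul_eq_mul, mul_comm]
  intro x _ y _ hxy
  rw [Function.onFun, Finset.disjoint_left]
  intro z hz hz'
  simp only [Finset.mem_insert, Finset.mem_singleton] at hz hz'
  apply hxy
  apply h.eq_of_eq_or_eq_neg
  rcases hz with rfl | rfl <;> rcases hz' with hz' | hz'
  · exact Or.inl hz'
  · exact Or.inr hz'
  · exact Or.inr (neg_eq_iff_eq_neg.1 hz')
  · exact Or.inl (neg_injective hz')

variable [Fintype K] {q Z ε : ℤ}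

/-- Every value is the pairing of a given point with another point. -/
theorem exists_polar_eq (h : IsUnitRepresentative Q rep) (hc : QuadricCounts Q q Z ε)
    (hq : 4 ≤ q) (hZ : q ≤ Z) (x : X) (γ : K) :
    ∃ y w, x ≠ y ∧ (w = rep y ∨ w = -rep y) ∧ QuadraticMap.polar Q (rep x) w = γ := by
  classical
  have h1 := hc.section_one (rep x) (h.ne_zero x) 1 γ
  have h2 : ((Finset.univ.filter fun s : K => s * s * Q (rep x) + s * γ + 1 = 0).card : ℤ) ≤
      q := by
    rw [← hc.card_field]
    exact_mod_cast Finset.card_le_univ _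
  have h3 : (0 : ℤ) ≤ (Finset.univ.filter fun s : K => s * s * Q (rep x) + s * γ + 1 = 0).card :=
    Nat.cast_nonneg _
  generalize ((Finset.univ.filter fun s : K => s * s * Q (rep x) + s * γ + 1 = 0).card : ℤ) = M
    at *
  have h4 : 16 ≤ Z * q := by nlinarith
  have h5 : 2 < Z * q * (Z * q + ε * (M - 1)) := by
    have h6 : 4 * q ≤ Z * q := by nlinarith
    have h7 : 1 ≤ Z * q + ε * (M - 1) := by
      rcases hc.sign with rfl | rfl <;> linarith
    nlinarith
  have h8 : ({rep x, -rep x} : Finset V).card < (Finset.univ.filter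
      fun z : V => Q z = 1 ∧ QuadraticMap.polar Q z (rep x) = γ).card := by
    refine Finset.card_le_two.trans_lt ?_
    have : Z ^ 2 * q ^ 2 + ε * Z * q * (M - 1) = Z * q * (Z * q + ε * (M - 1)) := by ring
    rw [this] at h1
    exact_mod_cast h1 ▸ h5
  obtain ⟨w, hw, hw'⟩ := Finset.exists_mem_notMem_of_card_lt_card h8
  simp only [Finset.mem_filter, Finset.mem_univ, true_and] at hw
  obtain ⟨y, hy⟩ := h.exists_eq_or_eq_neg w hw.1
  refine ⟨y, w, ?_, hy, by rw [QuadraticMap.polar_comm, hw.2]⟩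
  rintro rfl
  simp only [Finset.mem_insert, Finset.mem_singleton] at hw'
  exact hw' hy

variable [Fintype X]

theorem card_pairType_eq (h : IsUnitRepresentative Q rep) (hc : QuadricCounts Q q Z ε) (x : X)
    (t : K) :
    (({1, -1} : Finset K).card * (Finset.univ.filter fun y => pairType Q rep x y = t).card : ℤ) =
      Z ^ 2 * q ^ 2 * sqrtCount t + ε * Z * q * (sqrtRootCount t - sqrtCount t) := by
  have h1 := h.card_mul_card (fun z => QuadraticMap.polar Q z (rep x) *
    QuadraticMap.polar Q z (rep x) = t) (fun z => by
      rw [QuadraticMap.polar_neg_left, neg_mul_neg])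
  have h2 : (Finset.univ.filter fun y => pairType Q rep x y = t) = Finset.univ.filter fun y =>
      QuadraticMap.polar Q (rep y) (rep x) * QuadraticMap.polar Q (rep y) (rep x) = t := by
    refine Finset.filter_congr fun y _ => ?_
    rw [pairType_comm, pairType]
  rw [h2, ← Nat.cast_mul, h1,
    Finset.card_eq_sum_card_fiberwise (f := fun z => QuadraticMap.polar Q z (rep x))
      (t := Finset.univ.filter fun α => α * α = t) (fun z hz => by
        simpa using ((Finset.mem_filter.1 hz).2).2)]
  have h3 : ∀ α ∈ Finset.univ.filter (fun α : K => α * α = t),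
      (((Finset.univ.filter fun z => Q z = 1 ∧ QuadraticMap.polar Q z (rep x) *
        QuadraticMap.polar Q z (rep x) = t).filter
          fun z => QuadraticMap.polar Q z (rep x) = α).card : ℤ) =
      Z ^ 2 * q ^ 2 + ε * Z * q * (rootCount α - 1) := by
    intro α hα
    have h4 := hc.section_one (rep x) (h.ne_zero x) 1 α
    rw [h.map_eq_one] at h4
    simp only [mul_one] at h4
    rw [rootCount, ← h4, Finset.filter_filter]
    congr 2
    refine Finset.filter_congr fun z _ => ?_
    constructor
    · exact fun hz => ⟨hz.1.1, hz.2⟩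
    · rintro ⟨hz, rfl⟩
      exact ⟨⟨hz, (Finset.mem_filter.1 hα).2⟩, rfl⟩
  rw [Nat.cast_sum, Finset.sum_congr rfl h3, sqrtCount, sqrtRootCount, ← Finset.sum_filter]
  rw [Finset.sum_add_distrib, Finset.sum_const, ← Finset.mul_sum, Finset.sum_sub_distrib,
    Finset.sum_const, Nat.cast_sum]
  simp only [nsmul_eq_mul]
  ring

/-- The number of points related to two given points by types from `A`. -/
theorem card_pairType_mem (h : IsUnitRepresentative Q rep) (hc : QuadricCounts Q q Z ε) {x y : X}
    (hxy : x ≠ y) {w : V} (hw : w = rep y ∨ w = -rep y) (A : Finset K) :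
    (({1, -1} : Finset K).card * (Finset.univ.filter fun z =>
        pairType Q rep x z ∈ A ∧ pairType Q rep y z ∈ A).card : ℤ) =
      (Z ^ 2 * q - ε * Z * q) * (Finset.univ.filter fun p : K × K =>
        p.1 * p.1 ∈ A ∧ p.2 * p.2 ∈ A).card +
        ε * Z * pairCount A (QuadraticMap.polar Q (rep x) w) := by
  have hw1 : Q w = 1 := by
    rcases hw with rfl | rfl
    · exact h.map_eq_one y
    · rw [QuadraticMap.map_neg, h.map_eq_one]
  have h1 := h.card_mul_card (fun z => QuadraticMap.polar Q z (rep x) *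
    QuadraticMap.polar Q z (rep x) ∈ A ∧ QuadraticMap.polar Q z w * QuadraticMap.polar Q z w ∈ A)
    (fun z => by
      rw [QuadraticMap.polar_neg_left, neg_mul_neg, QuadraticMap.polar_neg_left, neg_mul_neg])
  have h2 : (Finset.univ.filter fun z => pairType Q rep x z ∈ A ∧ pairType Q rep y z ∈ A) =
      Finset.univ.filter fun z => QuadraticMap.polar Q (rep z) (rep x) *
        QuadraticMap.polar Q (rep z) (rep x) ∈ A ∧
        QuadraticMap.polar Q (rep z) w * QuadraticMap.polar Q (rep z) w ∈ A := by
    refine Finset.filter_congr fun z _ => ?_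
    rw [pairType_comm Q rep x, pairType_comm Q rep y, pairType, pairType]
    rcases hw with rfl | rfl
    · rfl
    · rw [QuadraticMap.polar_neg_right, neg_mul_neg]
  have hind : ∀ s r : K, s • rep x + r • w = 0 → s = 0 ∧ r = 0 := by
    apply eq_zero_of_smul_add_smul_eq_zero (h.map_eq_one x) hw1
    · rintro rfl
      exact hxy (h.eq_of_eq_or_eq_neg _ _ hw)
    · rintro rfl
      apply hxy
      apply h.eq_of_eq_or_eq_neg
      rcases hw with hw | hw
      · exact Or.inr (neg_eq_iff_eq_neg.1 hw)
      · exact Or.inl (neg_injective hw)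
  rw [h2, ← Nat.cast_mul, h1,
    Finset.card_eq_sum_card_fiberwise
      (f := fun z => (QuadraticMap.polar Q z (rep x), QuadraticMap.polar Q z w))
      (t := Finset.univ.filter fun p : K × K => p.1 * p.1 ∈ A ∧ p.2 * p.2 ∈ A) (fun z hz => by
        simpa using ((Finset.mem_filter.1 hz).2).2)]
  have h3 : ∀ p ∈ Finset.univ.filter (fun p : K × K => p.1 * p.1 ∈ A ∧ p.2 * p.2 ∈ A),
      (((Finset.univ.filter fun z => Q z = 1 ∧ QuadraticMap.polar Q z (rep x) *
        QuadraticMap.polar Q z (rep x) ∈ A ∧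
        QuadraticMap.polar Q z w * QuadraticMap.polar Q z w ∈ A).filter
          fun z => (QuadraticMap.polar Q z (rep x), QuadraticMap.polar Q z w) = p).card : ℤ) =
      Z ^ 2 * q - ε * Z * q +
        ε * Z * conicCount (QuadraticMap.polar Q (rep x) w) p.1 p.2 := by
    rintro ⟨α, β⟩ hp
    have h4 := hc.section_two (rep x) w hind 1 α β
    rw [h.map_eq_one, hw1] at h4
    have h5 : (Finset.univ.filter fun p : K × K =>
        p.1 * p.1 * 1 + p.1 * p.2 * QuadraticMap.polar Q (rep x) w + p.2 * p.2 * 1 +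
          (p.1 * α + p.2 * β) + 1 = 0).card = conicCount (QuadraticMap.polar Q (rep x) w) α β := by
      rw [conicCount]
      simp only [mul_one, mul_comm]
    rw [h5] at h4
    rw [Finset.filter_filter]
    have h6 : (Finset.univ.filter fun z => (Q z = 1 ∧ QuadraticMap.polar Q z (rep x) *
        QuadraticMap.polar Q z (rep x) ∈ A ∧
        QuadraticMap.polar Q z w * QuadraticMap.polar Q z w ∈ A) ∧
        (QuadraticMap.polar Q z (rep x), QuadraticMap.polar Q z w) = (α, β)) =
        Finset.univ.filter fun z => Q z = 1 ∧ QuadraticMap.polar Q z (rep x) = α ∧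
          QuadraticMap.polar Q z w = β := by
      refine Finset.filter_congr fun z _ => ?_
      rw [Prod.mk.injEq]
      constructor
      · exact fun hz => ⟨hz.1.1, hz.2⟩
      · rintro ⟨hz, rfl, rfl⟩
        exact ⟨⟨hz, (Finset.mem_filter.1 hp).2⟩, rfl, rfl⟩
    rw [h6, h4]
    ring
  rw [Nat.cast_sum, Finset.sum_congr rfl h3, Finset.sum_add_distrib, ← Finset.mul_sum,
    Finset.sum_const, pairCount, ← Fintype.sum_prod_type', ← Finset.sum_filter, Nat.cast_sum]
  simp only [nsmul_eq_mul]
  ring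

end IsUnitRepresentative

end UnitPoints

/-! ### What the valency determines -/

section Counting

variable {R : Type*} [Field R] [Fintype R] [DecidableEq R]

theorem sqrtCount_le_two (t : R) : sqrtCount t ≤ 2 := by
  by_cases h : ∃ α : R, α * α = t
  · obtain ⟨α, rfl⟩ := h
    refine (Finset.card_le_card (t := {α, -α}) fun β hβ => ?_).trans Finset.card_le_two
    simpa using mul_self_eq_mul_self_iff.1 (Finset.mem_filter.1 hβ).2
  · push Not at h
    simp [sqrtCount, h]

theorem sqrtRootCount_le (t : R) : sqrtRootCount t ≤ 2 * Fintype.card R := by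
  rw [sqrtRootCount, ← Finset.sum_filter]
  refine (Finset.sum_le_card_nsmul _ _ (Fintype.card R) fun α _ => Finset.card_le_univ _).trans ?_
  exact Nat.mul_le_mul_right _ (sqrtCount_le_two t)

/-- The valency `k` determines the numbers that enter its formula. -/
theorem eq_of_valency_eq {q Z ε e k δ δ' n n' r r' : ℤ} (hq : 4 ≤ q) (hZ : q ≤ Z)
    (hε : ε = 1 ∨ ε = -1) (he : 0 < e) (he' : e ≤ 2) (hδ : 0 ≤ δ ∧ δ ≤ 1) (hδ' : 0 ≤ δ' ∧ δ' ≤ 1)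
    (hn : 0 ≤ n ∧ n ≤ 2) (hn' : 0 ≤ n' ∧ n' ≤ 2) (hr : 0 ≤ r ∧ r ≤ 2 * q)
    (hr' : 0 ≤ r' ∧ r' ≤ 2 * q)
    (h : e * (k + δ) = Z ^ 2 * q ^ 2 * n + ε * Z * q * (r - n))
    (h' : e * (k + δ') = Z ^ 2 * q ^ 2 * n' + ε * Z * q * (r' - n')) :
    n = n' ∧ r = r' ∧ δ = δ' := by
  have hW : 4 * q ≤ Z * q := by nlinarith
  -- The two formulas are compared like expansions in base Zq: the differences of δ, then of r - n,
  -- are divisible by Zq but too small to be nonzero.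
  have h1 : Z * q ∣ e * (δ - δ') :=
    ⟨Z * q * (n - n') + ε * (r - n - (r' - n')), by linear_combination h - h'⟩
  have h2 : e * (δ - δ') = 0 := by
    refine Int.eq_zero_of_abs_lt_dvd h1 ?_
    rw [abs_lt]
    constructor <;> nlinarith
  have h3 : δ = δ' := by
    rcases mul_eq_zero.1 h2 with h3 | h3
    · omega
    · linarith
  subst h3
  have hW0 : Z * q ≠ 0 := (by linarith : 0 < Z * q).ne'
  have h4 : Z * q * (n - n') = -(ε * (r - n - (r' - n'))) := by
    apply mul_left_cancel₀ hW0
    linear_combination h' - h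
  have h5 : ε * (r - n - (r' - n')) = 0 := by
    refine Int.eq_zero_of_abs_lt_dvd (m := Z * q) ⟨-(n - n'), by linear_combination h4⟩ ?_
    rw [abs_lt]
    rcases hε with rfl | rfl <;> constructor <;> linarith
  rw [h5, neg_zero] at h4
  have h6 : n = n' := by
    rcases mul_eq_zero.1 h4 with h6 | h6
    · exact absurd h6 hW0
    · linarith
  refine ⟨h6, ?_, rfl⟩
  rcases hε with rfl | rfl <;> linarith

end Counting

/-! ### Non-constancy of the number of common neighbours -/

section StronglyRegular

variable {K V X : Type*} [Field K] [Fintype K] [DecidableEq K] [AddCommGroup V] [Module K V]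
  [Fintype V] [Fintype X] [DecidableEq X] {Q : QuadraticForm K V} {rep : X → V} {q Z ε : ℤ}

/-- The correction at t = 4 restores x itself, which has type 4 with itself and is not its own
neighbour. -/
theorem IsUnitRepresentative.card_erase_mul (h : IsUnitRepresentative Q rep)
    (hc : QuadricCounts Q q Z ε) (x : X) (t : K) :
    (({1, -1} : Finset K).card : ℤ) *
        ((Finset.univ.filter fun y => x ≠ y ∧ pairType Q rep x y = t).card +
          (if t = 4 then 1 else 0)) =
      Z ^ 2 * q ^ 2 * sqrtCount t + ε * Z * q * (sqrtRootCount t - sqrtCount t) := by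
  rw [← h.card_pairType_eq hc x t]
  congr 1
  by_cases ht : t = 4
  · have h1 : (Finset.univ.filter fun y => x ≠ y ∧ pairType Q rep x y = t) =
        (Finset.univ.filter fun y => pairType Q rep x y = t).erase x := by
      ext y
      simp [ne_comm]
    have h2 : x ∈ Finset.univ.filter fun y => pairType Q rep x y = t := by
      simp [ht, h.pairType_self]
    rw [h1, if_pos ht, ← Finset.card_erase_add_one h2]
    push_cast
    rfl
  · rw [if_neg ht, add_zero]
    congr 2
    refine Finset.filter_congr fun y _ => ⟨fun hy => hy.2, fun hy => ⟨?_, hy⟩⟩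
    rintro rfl
    exact ht (hy.symm.trans (h.pairType_self x))

/-- A graph given by a set of pair types of constant valency is not strongly regular. -/
theorem IsUnitRepresentative.not_isStronglyRegular (h : IsUnitRepresentative Q rep)
    (hc : QuadricCounts Q q Z ε) (hq : 4 ≤ q) (hZ : q ≤ Z) (hK : ConicsSeparate K)
    (A : Finset K) (x₀ : X) (hne : A.Nonempty) (hA : ∀ t ∈ A, ∃ x y, pairType Q rep x y = t)
    (hval : ∀ t ∈ A, ∀ t' ∈ A, ∃ x x',
      (Finset.univ.filter fun y => x ≠ y ∧ pairType Q rep x y = t).card =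
        (Finset.univ.filter fun y => x' ≠ y ∧ pairType Q rep x' y = t').card)
    (Γ : SimpleGraph X) (hΓ : ∀ x y, Γ.Adj x y ↔ x ≠ y ∧ pairType Q rep x y ∈ A) :
    ¬ IsStronglyRegular Γ := by
  classical
  rintro ⟨v, k, l, μ, hsrg⟩
  have he1 : (0 : ℤ) < ({1, -1} : Finset K).card := by
    exact_mod_cast Finset.card_pos.2 (Finset.insert_nonempty _ _)
  have he2 : (({1, -1} : Finset K).card : ℤ) ≤ 2 := by exact_mod_cast Finset.card_le_two
  obtain ⟨γ, γ', hγ, hγ', hsep⟩ := hK A hne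
    (fun t ht => by
      obtain ⟨x, y, hxy⟩ := hA t ht
      exact ⟨_, hxy⟩)
    (fun t ht t' ht' => by
      obtain ⟨x, x', hxx⟩ := hval t ht t' ht'
      have h1 := h.card_erase_mul hc x t
      have h2 := h.card_erase_mul hc x' t'
      rw [hxx] at h1
      have hite : ∀ t : K, (0 : ℤ) ≤ (if t = 4 then 1 else 0) ∧
          (if t = 4 then 1 else 0 : ℤ) ≤ 1 := by
        intro t
        split_ifs <;> simp
      have hn : ∀ t : K, (0 : ℤ) ≤ sqrtCount t ∧ (sqrtCount t : ℤ) ≤ 2 := fun t =>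
        ⟨Nat.cast_nonneg _, by exact_mod_cast sqrtCount_le_two t⟩
      have hr : ∀ t : K, (0 : ℤ) ≤ sqrtRootCount t ∧ (sqrtRootCount t : ℤ) ≤ 2 * q := fun t =>
        ⟨Nat.cast_nonneg _, by rw [← hc.card_field]; exact_mod_cast sqrtRootCount_le t⟩
      obtain ⟨h3, h4, h5⟩ := eq_of_valency_eq hq hZ hc.sign he1 he2 (hite t) (hite t') (hn t)
        (hn t') (hr t) (hr t') h1 h2
      refine ⟨by exact_mod_cast h3, by exact_mod_cast h4, ?_⟩
      by_cases h6 : t = 4 <;> by_cases h7 : t' = 4 <;> simp [h6, h7] at h5 ⊢)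
  have key : ∀ γ : K, γ * γ ∉ A → (({1, -1} : Finset K).card * μ : ℤ) =
      (Z ^ 2 * q - ε * Z * q) * (Finset.univ.filter fun p : K × K =>
        p.1 * p.1 ∈ A ∧ p.2 * p.2 ∈ A).card + ε * Z * pairCount A γ := by
    intro γ hγ
    obtain ⟨y, w, hxy, hw, rfl⟩ := h.exists_polar_eq hc hq hZ x₀ γ
    rw [← h.card_pairType_mem hc hxy hw A]
    have htype : pairType Q rep x₀ y ∉ A := by
      rcases hw with rfl | rfl
      · exact hγ
      · rwa [QuadraticMap.polar_neg_right, neg_mul_neg] at hγ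
    rw [← hsrg.of_not_adj hxy (fun hadj => htype ((hΓ _ _).1 hadj).2), Fintype.card_subtype]
    congr 3
    refine Finset.filter_congr fun z _ => ?_
    rw [SimpleGraph.mem_commonNeighbors, hΓ, hΓ]
    -- The conditions z ≠ x₀ and z ≠ y are automatic, because the type of (x₀, y) is not in A.
    refine ⟨fun hz => ⟨hz.1.2, hz.2.2⟩, fun hz => ⟨⟨?_, hz.1⟩, ⟨?_, hz.2⟩⟩⟩
    · rintro rfl
      exact htype (pairType_comm Q rep _ _ ▸ hz.2)
    · rintro rfl
      exact htype hz.1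
  have h1 := (key γ hγ).symm.trans (key γ' hγ')
  have h2 : ε * Z ≠ 0 := by
    apply mul_ne_zero
    · rcases hc.sign with rfl | rfl <;> norm_num
    · omega
  apply hsep
  have h3 := mul_left_cancel₀ h2 (add_left_cancel h1)
  exact_mod_cast h3

end StronglyRegular

/-! ### Orbitals as unions of classes of pair types -/

section Orbitals

variable {K V G X : Type*} [Field K] [Fintype K] [DecidableEq K] [AddCommGroup V] [Module K V]
  [Fintype V] [Group G] [Fintype X] [MulAction G X] {Q : QuadraticForm K V}
  {rep : X → V} {q Z ε : ℤ}

/-- The orbitals of a group are not strongly regular if the group has a normal subgroup that acts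
on the points as `Ω(V, Q)` does. -/
theorem IsUnitRepresentative.not_isStronglyRegular_orbitalGraph
    (h : IsUnitRepresentative Q rep) (hc : QuadricCounts Q q Z ε) (hq : 4 ≤ q) (hZ : q ≤ Z)
    (hK : ConicsSeparate K) (N : Subgroup G) [N.Normal]
    (hinv : ∀ n ∈ N, ∀ x y : X, pairType Q rep (n • x) (n • y) = pairType Q rep x y)
    (htrans : ∀ x y x' y' : X, x ≠ y → x' ≠ y' → pairType Q rep x y = pairType Q rep x' y' →
      ∃ n ∈ N, n • x = x' ∧ n • y = y')
    {x₀ y₀ : X} (hne : x₀ ≠ y₀) :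
    ¬ IsStronglyRegular (orbitalGraph (MulAction.orbit G (x₀, y₀))) := by
  classical
  set A : Finset K := Finset.univ.filter fun t =>
    ∃ g : G, pairType Q rep (g • x₀) (g • y₀) = t with hAdef
  have hmem : ∀ x y, (x, y) ∈ MulAction.orbit G (x₀, y₀) ↔ x ≠ y ∧ pairType Q rep x y ∈ A := by
    intro x y
    constructor
    · rintro ⟨g, hg⟩
      obtain ⟨rfl, rfl⟩ := Prod.mk.inj hg
      refine ⟨fun h => hne (MulAction.injective g h), ?_⟩
      rw [hAdef, Finset.mem_filter]
      exact ⟨Finset.mem_univ _, g, rfl⟩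
    · rintro ⟨hxy, hA⟩
      obtain ⟨g, hg⟩ := (Finset.mem_filter.1 hA).2
      obtain ⟨n, -, rfl, rfl⟩ := htrans (g • x₀) (g • y₀) x y
        (fun h => hne (MulAction.injective g h)) hxy hg
      exact ⟨n * g, by simp [mul_smul]⟩
  have hle : ∀ g g' : G, ∀ t t' : K, pairType Q rep (g • x₀) (g • y₀) = t →
      pairType Q rep (g' • x₀) (g' • y₀) = t' →
      (Finset.univ.filter fun y => g • x₀ ≠ y ∧ pairType Q rep (g • x₀) y = t).card ≤
        (Finset.univ.filter fun y => g' • x₀ ≠ y ∧ pairType Q rep (g' • x₀) y = t').card := by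
    intro g g' t t' ht ht'
    -- Translation by g'g⁻¹ carries one suborbit of N into the other: if n in N fixes g • x₀ and
    -- moves g • y₀ to y, its conjugate lies in N, fixes g' • x₀ and moves g' • y₀ to the image of
    -- y.
    refine Finset.card_le_card_of_injOn (fun y => (g' * g⁻¹) • y) (fun y hy => ?_)
      (MulAction.injective (g' * g⁻¹)).injOn
    simp only [Finset.coe_filter, Finset.mem_univ, true_and, Set.mem_ofPred_eq] at hy ⊢
    obtain ⟨n, hn, hnx, rfl⟩ := htrans (g • x₀) (g • y₀) (g • x₀) y
      (fun h => hne (MulAction.injective g h)) hy.1 (ht.trans hy.2.symm)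
    have hx : (g' * g⁻¹ * n * (g' * g⁻¹)⁻¹) • g' • x₀ = g' • x₀ := by
      have h1 : (g' * g⁻¹)⁻¹ • g' • x₀ = g • x₀ := by simp [mul_smul]
      rw [mul_smul, h1, mul_smul, hnx]
      simp [mul_smul]
    have hy' : (g' * g⁻¹ * n * (g' * g⁻¹)⁻¹) • g' • y₀ = (g' * g⁻¹) • n • g • y₀ := by
      simp [mul_smul]
    have hconj := Subgroup.Normal.conj_mem ‹N.Normal› n hn (g' * g⁻¹)
    rw [← hy']
    refine ⟨?_, ?_⟩
    · intro heq
      rw [← hx] at heq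
      exact hne (MulAction.injective g' (MulAction.injective _ heq))
    · rw [← ht', ← hinv _ hconj (g' • x₀) (g' • y₀), hx]
  refine h.not_isStronglyRegular hc hq hZ hK A x₀ ?_ ?_ ?_ _ ?_
  · exact ⟨_, ((hmem x₀ y₀).1 (MulAction.mem_orbit_self _)).2⟩
  · intro t ht
    obtain ⟨g, hg⟩ := (Finset.mem_filter.1 ht).2
    exact ⟨_, _, hg⟩
  · intro t ht t' ht'
    obtain ⟨g, hg⟩ := (Finset.mem_filter.1 ht).2
    obtain ⟨g', hg'⟩ := (Finset.mem_filter.1 ht').2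
    exact ⟨_, _, le_antisymm (hle g g' t t' hg hg') (hle g' g t' t hg' hg)⟩
  · intro x y
    rw [orbitalGraph, SimpleGraph.fromRel_adj, hmem, hmem, pairType_comm Q rep y x]
    constructor
    · rintro ⟨hxy, h | h⟩
      · exact h
      · exact ⟨hxy, h.2⟩
    · exact fun h => ⟨h.1, Or.inl h⟩

end Orbitals

theorem groupSocle_normal (G : Type*) [Group G] : (groupSocle G).Normal :=
  Subgroup.sSup_normal _ fun _ hN => hN.1

/-! ### Normalising the nonsingular point to norm 1 -/

section Scaling

variable {K V : Type*} [Field K] [AddCommGroup V] [Module K V]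

theorem pOmegaGroup_smul (Q : QuadraticForm K V) {c : K} (hc : c ≠ 0) :
    pOmegaGroup (c • Q) = pOmegaGroup Q := by
  have h : isometryGroup (c • Q) = isometryGroup Q := by
    ext g
    simp [mem_isometryGroup, hc]
  rw [pOmegaGroup, pOmegaGroup, omegaGroup, omegaGroup, h]

theorem polarBilin_smul_nondegenerate {Q : QuadraticForm K V} (hQ : Q.polarBilin.Nondegenerate)
    {c : K} (hc : c ≠ 0) : (c • Q).polarBilin.Nondegenerate := by
  have h : ∀ x y, (c • Q).polarBilin x y = c * Q.polarBilin x y := fun x y => by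
    simp [QuadraticMap.polar_smul]
  refine ⟨fun x hx => hQ.1 x fun y => ?_, fun y hy => hQ.2 y fun x => ?_⟩
  · simpa [h, hc] using hx y
  · simpa [h, hc] using hy x

theorem mk_eq_mk_of_map_eq_one {Q : QuadraticForm K V} {v w : V} (hv : Q v = 1) (hw : Q w = 1)
    (hv0 : v ≠ 0) (hw0 : w ≠ 0) :
    Projectivization.mk K v hv0 = Projectivization.mk K w hw0 ↔ v = w ∨ v = -w := by
  rw [Projectivization.mk_eq_mk_iff']
  constructor
  · rintro ⟨a, rfl⟩
    rw [QuadraticMap.map_smul, hw, smul_eq_mul, mul_one, mul_self_eq_one_iff] at hv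
    rcases hv with rfl | rfl
    · exact Or.inl (one_smul K w)
    · exact Or.inr (by rw [neg_smul, one_smul])
  · rintro (rfl | rfl)
    · exact ⟨1, one_smul K v⟩
    · exact ⟨-1, by rw [neg_smul, one_smul]⟩

end Scaling

/-! ### Identification of the permutation action -/

section UnitPoint

variable {K V G X : Type*} [Field K] [Fintype K] [DecidableEq K] [AddCommGroup V] [Module K V]
  [Fintype V] [Group G] [Fintype X] [MulAction G X]

theorem not_isStronglyRegular_orbitalGraph_of_map_eq_one {Q : QuadraticForm K V} {q Z ε : ℤ}
    (hc : QuadricCounts Q q Z ε) (hq : 4 ≤ q) (hZ : q ≤ Z) (hK : ConicsSeparate K)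
    {N : Subgroup G} [N.Normal] [MulAction.IsQuasiPreprimitive G X]
    (φ : N ≃* pOmegaGroup Q) (a : X) {v₀ : V} (hv₀ : Q v₀ = 1) (hv₀' : v₀ ≠ 0)
    (hstab : (MulAction.stabilizer N a).map φ.toMonoidHom =
      MulAction.stabilizer (pOmegaGroup Q) (Projectivization.mk K v₀ hv₀'))
    {x₀ y₀ : X} (hne : x₀ ≠ y₀) :
    ¬ IsStronglyRegular (orbitalGraph (MulAction.orbit G (x₀, y₀))) := by
  have hne0 : ∀ x : V, Q x = 1 → x ≠ 0 := by
    rintro x hx rfl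
    exact one_ne_zero (hx.symm.trans (QuadraticMap.map_zero Q))
  have hiso : ∀ g ∈ omegaGroup Q, ∀ v, Q (g v) = Q v := fun g hg =>
    mem_isometryGroup.1 (omegaGroup_le_isometryGroup Q hg)
  have hlift : ∀ n : N, ∃ g ∈ omegaGroup Q, ∀ (v : V) (hv : Q v = 1),
      φ n • Projectivization.mk K v (hne0 v hv) =
        Projectivization.mk K (g v) (by simpa using hne0 v hv) := by
    intro n
    obtain ⟨g, hg, hgn⟩ := (φ n).2
    refine ⟨g, hg, fun v hv => ?_⟩
    rw [Subgroup.smul_def, ← hgn]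
    rfl
  have hdrop : ∀ g ∈ omegaGroup Q, ∃ n : N, ∀ (v : V) (hv : Q v = 1),
      φ n • Projectivization.mk K v (hne0 v hv) =
        Projectivization.mk K (g v) (by simpa using hne0 v hv) := by
    intro g hg
    refine ⟨φ.symm ⟨_, g, hg, rfl⟩, fun v hv => ?_⟩
    rw [MulEquiv.apply_symm_apply]
    rfl
  have hstab' : ∀ n : N, n • a = a ↔
      φ n • Projectivization.mk K v₀ hv₀' = Projectivization.mk K v₀ hv₀' := by
    intro n
    rw [← MulAction.mem_stabilizer_iff, ← MulAction.mem_stabilizer_iff, ← hstab]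
    constructor
    · exact fun hn => ⟨n, hn, rfl⟩
    · rintro ⟨n', hn', hφ⟩
      rwa [← φ.injective hφ]
  have htrans : MulAction.IsPretransitive N X := by
    apply MulAction.IsQuasiPreprimitive.isPretransitive_of_normal (G := G)
    intro hfix
    -- If N acted trivially, Ω would fix the line of v₀. But it moves v₀ to every z of norm 1, and
    -- pairings with ±v₀ other than 2 exclude z = ±v₀.
    obtain ⟨z, hz, h1, h2⟩ := hc.exists_polar_ne_ne hq hZ hv₀' (neg_ne_zero.2 hv₀')
      (one_ne_zero (α := K)) 2
    obtain ⟨g, hg, rfl⟩ := hc.exists_omega hq hZ hv₀ hz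
    obtain ⟨n, hn⟩ := hdrop g hg
    have h3 : n • a = a := (hfix ▸ Set.mem_univ a : a ∈ MulAction.fixedPoints N X) n
    have h4 := (hn v₀ hv₀).symm.trans ((hstab' n).1 h3)
    rw [mk_eq_mk_of_map_eq_one hz hv₀] at h4
    rcases h4 with h4 | h4
    · apply h1
      rw [h4, QuadraticMap.polar_self, hv₀, two_nsmul]
      norm_num
    · apply h2
      rw [h4, QuadraticMap.polar_neg_left, QuadraticMap.polar_neg_right, neg_neg,
        QuadraticMap.polar_self, hv₀, two_nsmul]
      norm_num
  choose s hs using fun x : X => MulAction.exists_smul_eq N a x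
  -- Since φ matches the stabilisers, sending n • a to the image of the line of v₀ under φ n is well
  -- defined and injective.
  set F : X → ℙ K V := fun x => φ (s x) • Projectivization.mk K v₀ hv₀' with hF
  have hFn : ∀ n : N, F (n • a) = φ n • Projectivization.mk K v₀ hv₀' := by
    intro n
    have h1 : (n⁻¹ * s (n • a)) • a = a := by rw [mul_smul, hs, inv_smul_smul]
    have h2 := (hstab' _).1 h1
    rw [map_mul, mul_smul, map_inv, inv_smul_eq_iff] at h2
    exact h2
  have hFsmul : ∀ (n : N) (x : X), F (n • x) = φ n • F x := by
    intro n x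
    rw [← hs x, ← mul_smul, hFn, hFn, map_mul, mul_smul]
  have hFinj : Function.Injective F := by
    intro x y hxy
    have h1 : ((s y)⁻¹ * s x) • a = a := by
      rw [hstab', map_mul, map_inv, mul_smul, inv_smul_eq_iff]
      exact hxy
    rw [mul_smul, inv_smul_eq_iff, hs, hs] at h1
    exact h1
  have hrep : ∀ x, ∃ z, ∃ hz : Q z = 1, F x = Projectivization.mk K z (hne0 z hz) := by
    intro x
    obtain ⟨g, hg, hgs⟩ := hlift (s x)
    exact ⟨g v₀, (hiso g hg v₀).trans hv₀, hgs v₀ hv₀⟩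
  choose rep hrep1 hrepF using hrep
  have hFeq : ∀ x y, F x = F y ↔ rep x = rep y ∨ rep x = -rep y := by
    intro x y
    rw [hrepF, hrepF, mk_eq_mk_of_map_eq_one (hrep1 x) (hrep1 y)]
  have h : IsUnitRepresentative Q rep := by
    refine ⟨hrep1, fun z hz => ?_, fun x y hxy => hFinj ((hFeq x y).2 hxy)⟩
    obtain ⟨g, hg, rfl⟩ := hc.exists_omega hq hZ hv₀ hz
    obtain ⟨n, hn⟩ := hdrop g hg
    refine ⟨n • a, ?_⟩
    rw [← mk_eq_mk_of_map_eq_one hz (hrep1 _) (hne0 _ hz) (hne0 _ (hrep1 _)), ← hrepF, hFn]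
    exact (hn v₀ hv₀).symm
  refine h.not_isStronglyRegular_orbitalGraph hc hq hZ hK N ?_ ?_ hne
  · intro n hn x y
    obtain ⟨g, hg, hgn⟩ := hlift ⟨n, hn⟩
    have h1 : ∀ x : X, rep (n • x) = g (rep x) ∨ rep (n • x) = -g (rep x) := by
      intro x
      rw [← mk_eq_mk_of_map_eq_one (hrep1 _) ((hiso g hg _).trans (hrep1 x)) (hne0 _ (hrep1 _))
        (hne0 _ ((hiso g hg _).trans (hrep1 x))), ← hrepF]
      have h2 := hFsmul ⟨n, hn⟩ x
      rw [hrepF x, hgn _ (hrep1 x)] at h2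
      exact h2
    have h2 := polar_isometry (omegaGroup_le_isometryGroup Q hg) (rep x) (rep y)
    rw [pairType, pairType, ← h2]
    rcases h1 x with hx | hx <;> rcases h1 y with hy | hy <;>
      simp [hx, hy, QuadraticMap.polar_neg_left, QuadraticMap.polar_neg_right]
  · intro x y x' y' hxy hxy' ht
    -- The type fixes the pairing only up to sign, which is absorbed by the choice of representative
    -- of y'.
    obtain ⟨w, hw, hpw⟩ : ∃ w, (w = rep y' ∨ w = -rep y') ∧
        QuadraticMap.polar Q (rep x) (rep y) = QuadraticMap.polar Q (rep x') w := by
      rcases mul_self_eq_mul_self_iff.1 ht with h1 | h1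
      · exact ⟨_, Or.inl rfl, h1⟩
      · exact ⟨_, Or.inr rfl, by rw [h1, QuadraticMap.polar_neg_right]⟩
    have hw1 : Q w = 1 := by
      rcases hw with rfl | rfl
      · exact hrep1 y'
      · rw [QuadraticMap.map_neg, hrep1]
    obtain ⟨g, hg, hgx⟩ := hc.exists_omega hq hZ (hrep1 x) (hrep1 x')
    have hgy : Q (g (rep y)) = 1 := (hiso g hg _).trans (hrep1 y)
    obtain ⟨g', hg', hgx', hgy'⟩ := hc.exists_omega_fixing hq hZ (v := rep x') hgy hw1
      (eq_zero_of_smul_add_smul_eq_zero (hrep1 x') hgy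
        (fun h1 => hxy (h.eq_of_eq_or_eq_neg _ _
          (Or.inl (g.injective (hgx.trans h1.symm)))))
        (fun h1 => hxy (h.eq_of_eq_or_eq_neg _ _
          (Or.inr (g.injective (by rw [map_neg, h1, neg_neg, hgx]))))))
      (eq_zero_of_smul_add_smul_eq_zero (hrep1 x') hw1
        (fun h1 => hxy' (h.eq_of_eq_or_eq_neg _ _ (h1 ▸ hw)))
        (fun h1 => hxy' (h.eq_of_eq_or_eq_neg _ _ (by
          rcases hw with hw | hw
          · exact Or.inr (neg_eq_iff_eq_neg.1 (h1.symm.trans hw))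
          · exact Or.inl (neg_injective (h1.symm.trans hw))))))
      (by
        rw [QuadraticMap.polar_comm Q w, ← hpw, QuadraticMap.polar_comm, ← hgx,
          polar_isometry (omegaGroup_le_isometryGroup Q hg)])
    obtain ⟨n, hn⟩ := hdrop (g' * g) (mul_mem hg' hg)
    have hFn' : ∀ z z' : X, ((g' * g) (rep z) = rep z' ∨ (g' * g) (rep z) = -rep z') →
        (n : G) • z = z' := by
      intro z z' hz
      apply hFinj
      have h1 := hFsmul n z
      rw [hrepF z, hn _ (hrep1 z)] at h1
      refine h1.trans ?_
      rw [hrepF z', mk_eq_mk_of_map_eq_one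
        ((hiso _ (mul_mem hg' hg) _).trans (hrep1 z)) (hrep1 z')]
      exact hz
    refine ⟨n, n.2, hFn' x x' (Or.inl ?_), hFn' y y' ?_⟩
    · rw [LinearEquiv.mul_apply, hgx, hgx']
    · rw [LinearEquiv.mul_apply, hgy']
      exact hw

end UnitPoint

/-- Every nondegenerate quadratic form on a `2m`-dimensional space over a finite field has plus
or minus type, so `pOmegaGroup Q` ranges over the groups `PΩ⁺` and `PΩ⁻` in dimension `2m`. -/
theorem proposition3p6
    {K V : Type*} [Field K] [AddCommGroup V] [Module K V]
    {G X : Type*} [Group G] [Fintype X] [MulAction G X] [FaithfulSMul G X]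
    [MulAction.IsPreprimitive G X]
    (m : ℕ) (hm : 3 ≤ m)
    (hK : Nat.card K = 4 ∨ Nat.card K = 5)
    (hV : Module.finrank K V = 2 * m)
    (Q : QuadraticForm K V) (hQ : Q.polarBilin.Nondegenerate)
    (φ : groupSocle G ≃* pOmegaGroup Q)
    (a : X) (p : ℙ K V) (hp : IsNonsingularPoint Q p)
    (hstab : (MulAction.stabilizer (groupSocle G) a).map φ.toMonoidHom =
      MulAction.stabilizer (pOmegaGroup Q) p)
    (Δ : Set (X × X)) (hΔ : IsOrbital G Δ) (hdiag : Δ ≠ Set.diagonal X) :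
    ¬ IsStronglyRegular (orbitalGraph Δ) := by
  classical
  have : Finite K := (Nat.card_pos_iff.1 (by omega)).2
  have : FiniteDimensional K V := Module.finite_of_finrank_pos (by omega)
  have : Finite V := Module.finite_of_finite K
  let _ := Fintype.ofFinite K
  let _ := Fintype.ofFinite V
  rw [Nat.card_eq_fintype_card] at hK
  have := groupSocle_normal G
  obtain ⟨⟨x₀, y₀⟩, rfl⟩ := hΔ
  have hne : x₀ ≠ y₀ := by
    rintro rfl
    apply hdiag
    ext ⟨x, y⟩
    rw [Set.mem_diagonal_iff]
    constructor
    · rintro ⟨g, hg⟩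
      obtain ⟨rfl, rfl⟩ := Prod.mk.inj hg
      rfl
    · intro hxy
      obtain ⟨g, rfl⟩ := MulAction.exists_smul_eq G x₀ x
      exact ⟨g, Prod.ext rfl hxy⟩
  have hc : Q p.rep ≠ 0 :=
    hp _ (by rw [Projectivization.submodule_eq]; exact Submodule.mem_span_singleton_self _)
      p.rep_nonzero
  rw [← p.mk_rep] at hstab
  have hQ' := polarBilin_smul_nondegenerate hQ (inv_ne_zero hc)
  have hv : ((Q p.rep)⁻¹ • Q) p.rep = 1 := by
    rw [smul_apply, smul_eq_mul, inv_mul_cancel₀ hc]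
  obtain ⟨ε, hε⟩ := exists_quadricCounts hQ' (by omega) hV
  have hq : (4 : ℤ) ≤ Fintype.card K := by
    rcases hK with hK | hK <;> rw [hK] <;> norm_num
  -- This is where m ≥ 3 enters: the exponent m - 2 must be positive.
  have hZ : (Fintype.card K : ℤ) ≤ (Fintype.card K : ℤ) ^ (m - 2) :=
    le_self_pow₀ (by linarith) (by omega)
  have hcon := conicsSeparate_of_card hK
  -- `φ` and `hstab` depend on `pOmegaGroup Q`, so they are generalised before it is rewritten as
  -- the group of the scaled form.
  revert φ hstab
  rw [← pOmegaGroup_smul Q (inv_ne_zero hc)]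
  intro φ hstab
  exact not_isStronglyRegular_orbitalGraph_of_map_eq_one hε hq hZ hcon φ a hv p.rep_nonzero
    hstab hne
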